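/- Let $\mathbb k$ be $\mathbb R$ or $\mathbb C$ (or any nontrivially normed subfield of $\mathbb C$), and let $e(3)=\{(\mathbf x,\mathbf J)\in\mathbb k^3\times\mathbb k^3\}$ carry the Lie–Poisson bracket $\{J_i,J_j\}=\varepsilon_{ijk}J_k$, $\{J_i,x_j\}=\varepsilon_{ijk}x_k$, $\{x_i,x_j\}=0$, extended to differentiable $\mathbb C$-valued functions. Put $A=\mathbf x\cdot\mathbf x$, $B=\mathbf x\cdot\mathbf J$. For $c_1,c_2\in\mathbb C$ let $$\widehat H=J_1^2+J_2^2+2J_3^2+2c_1x_1+2c_2(x_2J_3-x_3J_2),\qquad \dot f:=\{\widehat H,f\},\qquad z_{1,2}=J_1\pm iJ_2,$$ $$\widehat\xi=z_1^2-2c_1(x_1+ix_2)-c_2\{\mathbf J^2,x_1+ix_2\}-c_2^2A,\quad \widehat\xi^*=z_2^2-2c_1(x_1-ix_2)-c_2\{\mathbf J^2,x_1-ix_2\}-c_2^2A,\quad \widehat K=\widehat\xi\,\widehat\xi^*,$$ $$F(z)=z^4-2\widehat Hz^2+8c_1Bz+\widehat K-4Ac_1^2+2c_2^2(2B^2-\widehat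 HA)-c_2^4A^2,$$ $$F(z_1,z_2)=\tfrac12\bigl(F(z_1)+F(z_2)-(z_1^2-z_2^2)^2\bigr),\qquad P_5=P_3P_2,$$ $$P_3(s)=s\bigl(4s^2+4s\widehat H+\widehat H^2-\widehat K+4c_1^2A+2c_2^2(\widehat HA-2B^2)+c_2^4A^2\bigr)+4c_1^2B^2,$$ $$P_2(s)=4s^2+4(\widehat H+c_2^2A)s+\widehat H^2-\widehat K+2c_2^2\widehat HA+c_2^4A^2.$$ (1) On all of $e(3)$: $\dot A=\dot B=\dot{\widehat K}=0$ (so the coefficients of $F$ are integrals of motion), and $$\dot z_1^2-F(z_1)+\widehat\xi\,(z_1-z_2)^2=0,\qquad \dot z_2^2-F(z_2)+\widehat\xi^*(z_1-z_2)^2=0.$$ (2) Let $U\subset e(3)$ be an open set on which $z_1\ne z_2$ and $F(z_1)F(z_2)\neq0$, and let $\sqrt{F(z_1)F(z_2)}$ be a continuous branch of the root on $U$. Then the functions $$s_{1,2}=\frac{F(z_1,z_2)\pm\sqrt{F(z_1)F(z_2)}}{2(z_1-z_2)^2}$$ are $C^\infty$ on $U$, $s_1\ne s_2$, $\{s_1,s_2\}=0$,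 and there are functions $\sqrt{P_5(s_1)}$, $\sqrt{P_5(s_2)}$ on $U$ (square roots of $P_5(s_1)$ and $P_5(s_2)$, of suitable signs) with $$\dot s_1=\frac{\sqrt{P_5(s_1)}}{s_1-s_2},\qquad \dot s_2=\frac{\sqrt{P_5(s_2)}}{s_2-s_1}.$$ (3) Suppose moreover that on $U$ the functions $s_i$, $P_5(s_i)$ and $(As_i+B^2)(c_1^2-c_2^2s_i)$ do not vanish, and let, for $i=1,2$, a continuous branch of $\sqrt{s_i}$ and one of the following logarithm be given on $U$: $$p_i=\frac1{4\sqrt{s_i}}\ln\left(\frac{2\sqrt{s_i}\sqrt{P_5(s_i)}-P_3(s_i)-s_iP_2(s_i)}{4(As_i+B^2)(c_1^2-c_2^2s_i)}\right),$$ where $\sqrt{P_5(s_i)}$ is the root occurring in (2). Then $p_1,p_2$ are $C^\infty$ on $U$, and there $$\{s_i,p_j\}=\delta_{ij},\qquad \{s_1,s_2\}=\{p_1,p_2\}=0;$$ at every point of $U$ the differentials of $A,B,s_1,s_2,p_1,p_2$ have no common nonzero null vector, so that $s_1,s_2,p_1,p_2$ are canonical coordinates on the symplectic leaves $A=a$,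 $B=b$. Moreover, with $a=A$, $b=B$ and $d_i=(c_2^2s_i-c_1^2)(as_i+b^2)/s_i$, $$\widehat H=-s_1-s_2+\frac{c_1^2b^2}{2s_1s_2}-\frac{ac_2^2}2+\frac{d_1\cosh(4p_1\sqrt{s_1})-d_2\cosh(4p_2\sqrt{s_2})}{2(s_1-s_2)},$$ and the separated equations hold for $i=1,2$: $$2s_i^3+(2\widehat H+c_2^2a)s_i^2-\kappa s_i+c_1^2b^2=(c_2^2s_i-c_1^2)(as_i+b^2)\cosh(4p_i\sqrt{s_i}),$$ where $2\kappa=\widehat K-(\widehat H+c_2^2a)^2-2c_1^2a+2c_2^2b^2$. -/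

import Mathlib

open scoped ContDiff

namespace DeformedKowalevski

noncomputable section

/-- The phase space of `e(3)`: a point is a pair `(x, J)`.  The scalars `𝕜` are `ℝ` (the physical
phase space), `ℂ` (its complexification), or any other normed subfield of `ℂ`. -/
abbrev E3 (𝕜 : Type*) : Type _ := (Fin 3 → 𝕜) × (Fin 3 → 𝕜)

section

variable {𝕜 : Type*} [NontriviallyNormedField 𝕜] [NormedAlgebra 𝕜 ℂ]

/-- The coordinate function `x_{k+1}`. -/
def x (k : Fin 3) (m : E3 𝕜) : ℂ := algebraMap 𝕜 ℂ (m.1 k)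

/-- The coordinate function `J_{k+1}`. -/
def J (k : Fin 3) (m : E3 𝕜) : ℂ := algebraMap 𝕜 ℂ (m.2 k)

/-- The partial derivatives of `f` with respect to `x₁, x₂, x₃`. -/
def gradx (f : E3 𝕜 → ℂ) (m : E3 𝕜) : Fin 3 → ℂ :=
  fun k => fderiv 𝕜 f m (Pi.single k 1, 0)

/-- The partial derivatives of `f` with respect to `J₁, J₂, J₃`. -/
def gradJ (f : E3 𝕜 → ℂ) (m : E3 𝕜) : Fin 3 → ℂ :=
  fun k => fderiv 𝕜 f m (0, Pi.single k 1)

/-- The Lie-Poisson bracket of `e(3)`, with `{J_i, J_j} = ε_{ijk} J_k`, `{J_i, x_j} = ε_{ijk} x_k`,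
`{x_i, x_j} = 0`, that is
`{f, g} = J · (∇_J f × ∇_J g) + x · (∇_J f × ∇_x g + ∇_x f × ∇_J g)`. -/
def bracket (f g : E3 𝕜 → ℂ) (m : E3 𝕜) : ℂ :=
  dotProduct (fun k => J k m) (crossProduct (gradJ f m) (gradJ g m)) +
    dotProduct (fun k => x k m)
      (crossProduct (gradJ f m) (gradx g m) + crossProduct (gradx f m) (gradJ g m))

/-- The Casimir function `A = x · x`. -/
def casA (m : E3 𝕜) : ℂ := ∑ k, x k m ^ 2

/-- The Casimir function `B = x · J`. -/
def casB (m : E3 𝕜) : ℂ := ∑ k, x k m * J k m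

/-- The function `J · J`. -/
def Jsq (m : E3 𝕜) : ℂ := ∑ k, J k m ^ 2

/-- The Hamilton function of the deformed Kowalevski top on `e(3)`. -/
def Ham (c₁ c₂ : ℂ) (m : E3 𝕜) : ℂ :=
  J 0 m ^ 2 + J 1 m ^ 2 + 2 * J 2 m ^ 2 + 2 * c₁ * x 0 m
    + 2 * c₂ * (x 1 m * J 2 m - x 2 m * J 1 m)

/-- `z₁ = J₁ + i J₂`. -/
def z₁ (m : E3 𝕜) : ℂ := J 0 m + Complex.I * J 1 m

/-- `z₂ = J₁ - i J₂`. -/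
def z₂ (m : E3 𝕜) : ℂ := J 0 m - Complex.I * J 1 m

/-- `ξ̂ = (J₁ + i J₂)² - 2 c₁ (x₁ + i x₂) - c₂ {J², x₁ + i x₂} - c₂² A`. -/
def xiHat (c₁ c₂ : ℂ) (m : E3 𝕜) : ℂ :=
  z₁ m ^ 2 - 2 * c₁ * (x 0 m + Complex.I * x 1 m)
    - c₂ * bracket Jsq (fun n => x 0 n + Complex.I * x 1 n) m - c₂ ^ 2 * casA m

/-- `ξ̂* = (J₁ - i J₂)² - 2 c₁ (x₁ - i x₂) - c₂ {J², x₁ - i x₂} - c₂² A`. -/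
def xiHatStar (c₁ c₂ : ℂ) (m : E3 𝕜) : ℂ :=
  z₂ m ^ 2 - 2 * c₁ * (x 0 m - Complex.I * x 1 m)
    - c₂ * bracket Jsq (fun n => x 0 n - Complex.I * x 1 n) m - c₂ ^ 2 * casA m

/-- The second integral of motion `K̂ = ξ̂ ξ̂*`. -/
def Kint (c₁ c₂ : ℂ) (m : E3 𝕜) : ℂ := xiHat c₁ c₂ m * xiHatStar c₁ c₂ m

/-- The quartic polynomial `F(z)`, its coefficients being evaluated at the phase point `m`. -/
def F (c₁ c₂ : ℂ) (m : E3 𝕜) (z : ℂ) : ℂ :=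
  z ^ 4 - 2 * Ham c₁ c₂ m * z ^ 2 + 8 * c₁ * casB m * z + Kint c₁ c₂ m - 4 * casA m * c₁ ^ 2
    + 2 * c₂ ^ 2 * (2 * casB m ^ 2 - Ham c₁ c₂ m * casA m) - c₂ ^ 4 * casA m ^ 2

/-- The biquadratic form `F(z₁, z₂)`, evaluated at the phase point `m`. -/
def F₂ (c₁ c₂ : ℂ) (m : E3 𝕜) : ℂ :=
  (F c₁ c₂ m (z₁ m) + F c₁ c₂ m (z₂ m) - (z₁ m ^ 2 - z₂ m ^ 2) ^ 2) / 2

/-- The separated variables `s₁` (`i = 0`) and `s₂` (`i = 1`), `R` being a branch of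
`√(F(z₁) F(z₂))`: `s_{1,2} = (F(z₁, z₂) ± R) / (2 (z₁ - z₂)²)`. -/
def sepVar (c₁ c₂ : ℂ) (R : E3 𝕜 → ℂ) (i : Fin 2) (m : E3 𝕜) : ℂ :=
  (F₂ c₁ c₂ m + (-1) ^ (i : ℕ) * R m) / (2 * (z₁ m - z₂ m) ^ 2)

/-- The cubic polynomial `P₃(s)`. -/
def P₃ (c₁ c₂ : ℂ) (m : E3 𝕜) (s : ℂ) : ℂ :=
  s * (4 * s ^ 2 + 4 * s * Ham c₁ c₂ m + Ham c₁ c₂ m ^ 2 - Kint c₁ c₂ m + 4 * c₁ ^ 2 * casA m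
      + 2 * c₂ ^ 2 * (Ham c₁ c₂ m * casA m - 2 * casB m ^ 2) + c₂ ^ 4 * casA m ^ 2)
    + 4 * c₁ ^ 2 * casB m ^ 2

/-- The quadratic polynomial `P₂(s)`. -/
def P₂ (c₁ c₂ : ℂ) (m : E3 𝕜) (s : ℂ) : ℂ :=
  4 * s ^ 2 + 4 * (Ham c₁ c₂ m + c₂ ^ 2 * casA m) * s + Ham c₁ c₂ m ^ 2 - Kint c₁ c₂ m
    + 2 * c₂ ^ 2 * Ham c₁ c₂ m * casA m + c₂ ^ 4 * casA m ^ 2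

/-- The quintic polynomial `P₅(s) = P₃(s) P₂(s)`. -/
def P₅ (c₁ c₂ : ℂ) (m : E3 𝕜) (s : ℂ) : ℂ := P₃ c₁ c₂ m s * P₂ c₁ c₂ m s

/-- The denominator `4 (a s + b²) (c₁² - c₂² s)` under the logarithm in the momenta. -/
def momDen (c₁ c₂ : ℂ) (m : E3 𝕜) (s : ℂ) : ℂ :=
  4 * (casA m * s + casB m ^ 2) * (c₁ ^ 2 - c₂ ^ 2 * s)

/-- The argument `(2 √(s P₅(s)) - P₃(s) - s P₂(s)) / (4 (a s + b²) (c₁² - c₂² s))` of the logarithm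
in the momenta, `w` being the value of the root `√(s P₅(s))`. -/
def momArg (c₁ c₂ : ℂ) (m : E3 𝕜) (s w : ℂ) : ℂ :=
  (2 * w - P₃ c₁ c₂ m s - s * P₂ c₁ c₂ m s) / momDen c₁ c₂ m s

/-- The momentum `p = (1 / (4 √s)) ln (…)`, `ρ` being a branch of `√s` and `ℓ` a branch of the
logarithm. -/
def momentum (ρ ℓ : E3 𝕜 → ℂ) (m : E3 𝕜) : ℂ := 1 / (4 * ρ m) * ℓ m

/-- The function `d(s) = (c₂² s - c₁²) (a s + b²) / s`. -/
def dFun (c₁ c₂ : ℂ) (m : E3 𝕜) (s : ℂ) : ℂ :=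
  (c₂ ^ 2 * s - c₁ ^ 2) * (casA m * s + casB m ^ 2) / s

/-- The separation constant `κ`,
`2 κ = K̂ - (Ĥ + c₂² a)² - 2 c₁² a + 2 c₂² b²`. -/
def kappa (c₁ c₂ : ℂ) (m : E3 𝕜) : ℂ :=
  (Kint c₁ c₂ m - (Ham c₁ c₂ m + c₂ ^ 2 * casA m) ^ 2 - 2 * c₁ ^ 2 * casA m
    + 2 * c₂ ^ 2 * casB m ^ 2) / 2

end

end

end DeformedKowalevski

open DeformedKowalevski

/-!
The proof never expands the separation variables in the coordinates of the phase space.  Everything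
that depends on the explicit form of the Poisson structure is contained in a few polynomial
identities for `z₁`, `z₂`, their velocities `u = ż₁`, `v = ż₂` and the integrals:
`u² = F(z₁) - ξ̂ (z₁ - z₂)²`, `v² = F(z₂) - ξ̂* (z₁ - z₂)²`,
`u v = -(F(z₁, z₂) + (z₁ - z₂)² (Ĥ + c₂² A))`, `(z₁ - z₂) {z₁, z₂} = u + v`, `{K̂, z₁} = 2 ξ̂ v`,
`{K̂, z₂} = 2 ξ̂* u` and `{Ĥ, K̂} = 0`.  The last three follow from the brackets of `ξ̂` and `ξ̂*`
with `z₁`, `z₂` and `Ĥ`.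

The rest is the theory of a root `s = (Φ + r) / (2 (a - b)²)`, `r² = f(a) f(b)`, attached to the
quartic `f(z) = z⁴ - 2 H z² + 2 e z + k` and its polarization `Φ`.  Its partial derivatives satisfy
Euler's relation `∂_b s = -(f(a) / r) ∂ₐ s` (`rootSa_swap`), the square `(∂ₐ s)² f(a)` is the
resolvent cubic at `s`, which is `P₃(s)` (`rootSa_sq`), and the derivatives with respect to `H` and
`k` are related to `∂ₐ s` by `rootSH_add`.  By the chain rule these facts give

* `((s₁ - s₂) ṡ₁)² = P₃(s₁) ((2 s₁ + Ĥ + c₂² A)² - K̂) = P₅(s₁)` (`velocity_sq`),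
* `{K̂, s₁} = 2 (2 s₂ + Ĥ + c₂² A) {Ĥ, s₁}` (`second_velocity`),
* `{s₁, s₂} = 0` (`roots_commute`).

For the momenta, `P₃(s) - s P₂(s)` is the denominator `4 (A s + B²) (c₁² - c₂² s)`, so that
`cosh (4 p √s)` is `-(P₃ + s P₂) / (P₃ - s P₂)`, which is the separated equation
(`cosh_sinh_mul_momDen`); the formula for `Ĥ` is the difference of the two separated equations.
Differentiating the separated equation gives `∂p/∂Ĥ = -(2 s + Ĥ + c₂² A) / (2 q)` and
`∂p/∂K̂ = 1 / (4 q)`, where `q` is the root of `P₅(s)` (`exists_hasFDerivAt_momentum`).  Together with the two velocities of `s₁` and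
`s₂` this yields the canonical brackets.  A canonical system of covectors, completed by `dA` and
`dB`, is linearly independent: the Poisson tensor has rank four, which excludes `x = 0`, and `dA, dB`
are independent elsewhere (`eq_zero_of_canonical`).
-/

namespace DeformedKowalevski

noncomputable section

/-! ### The Poisson tensor on covectors -/

section Covectors

variable {𝕜 : Type*} [NontriviallyNormedField 𝕜] [NormedAlgebra 𝕜 ℂ]

/-- The differential of the coordinate function `x k`. -/
def dx (k : Fin 3) : E3 𝕜 →L[𝕜] ℂ :=
  (algebraMapCLM 𝕜 ℂ).comp ((ContinuousLinearMap.proj k).comp (ContinuousLinearMap.fst 𝕜 _ _))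

/-- The differential of the coordinate function `J k`. -/
def dJ (k : Fin 3) : E3 𝕜 →L[𝕜] ℂ :=
  (algebraMapCLM 𝕜 ℂ).comp ((ContinuousLinearMap.proj k).comp (ContinuousLinearMap.snd 𝕜 _ _))

@[simp] lemma dx_apply (k : Fin 3) (v : E3 𝕜) : dx k v = algebraMap 𝕜 ℂ (v.1 k) := rfl

@[simp] lemma dJ_apply (k : Fin 3) (v : E3 𝕜) : dJ k v = algebraMap 𝕜 ℂ (v.2 k) := rfl

lemma hasFDerivAt_x (k : Fin 3) (m : E3 𝕜) : HasFDerivAt (x k) (dx k) m :=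
  (dx (𝕜 := 𝕜) k).hasFDerivAt

lemma hasFDerivAt_J (k : Fin 3) (m : E3 𝕜) : HasFDerivAt (J k) (dJ k) m :=
  (dJ (𝕜 := 𝕜) k).hasFDerivAt

/-- The Poisson tensor of `e(3)` at `m`, as a pairing of `ℂ`-valued covectors. -/
def poisson (m : E3 𝕜) (α β : E3 𝕜 →L[𝕜] ℂ) : ℂ :=
  dotProduct (fun k => J k m) (crossProduct (fun k => α (0, Pi.single k 1))
      (fun k => β (0, Pi.single k 1))) +
    dotProduct (fun k => x k m)
      (crossProduct (fun k => α (0, Pi.single k 1)) (fun k => β (Pi.single k 1, 0)) +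
        crossProduct (fun k => α (Pi.single k 1, 0)) (fun k => β (0, Pi.single k 1)))

lemma bracket_eq_poisson {f g : E3 𝕜 → ℂ} {m : E3 𝕜} {α β : E3 𝕜 →L[𝕜] ℂ}
    (hf : HasFDerivAt f α m) (hg : HasFDerivAt g β m) : bracket f g m = poisson m α β := by
  rw [← hf.fderiv, ← hg.fderiv]; rfl

lemma poisson_eq (m : E3 𝕜) (α β : E3 𝕜 →L[𝕜] ℂ) :
    poisson m α β =
      J 0 m * (α (0, Pi.single 1 1) * β (0, Pi.single 2 1)
          - α (0, Pi.single 2 1) * β (0, Pi.single 1 1))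
      + J 1 m * (α (0, Pi.single 2 1) * β (0, Pi.single 0 1)
          - α (0, Pi.single 0 1) * β (0, Pi.single 2 1))
      + J 2 m * (α (0, Pi.single 0 1) * β (0, Pi.single 1 1)
          - α (0, Pi.single 1 1) * β (0, Pi.single 0 1))
      + x 0 m * (α (0, Pi.single 1 1) * β (Pi.single 2 1, 0)
          - α (0, Pi.single 2 1) * β (Pi.single 1 1, 0)
          + α (Pi.single 1 1, 0) * β (0, Pi.single 2 1)
          - α (Pi.single 2 1, 0) * β (0, Pi.single 1 1))
      + x 1 m * (α (0, Pi.single 2 1) * β (Pi.single 0 1, 0)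
          - α (0, Pi.single 0 1) * β (Pi.single 2 1, 0)
          + α (Pi.single 2 1, 0) * β (0, Pi.single 0 1)
          - α (Pi.single 0 1, 0) * β (0, Pi.single 2 1))
      + x 2 m * (α (0, Pi.single 0 1) * β (Pi.single 1 1, 0)
          - α (0, Pi.single 1 1) * β (Pi.single 0 1, 0)
          + α (Pi.single 0 1, 0) * β (0, Pi.single 1 1)
          - α (Pi.single 1 1, 0) * β (0, Pi.single 0 1)) := by
  simp only [poisson, cross_apply, dotProduct, Fin.sum_univ_three, Pi.add_apply,
    Matrix.cons_val_zero, Matrix.cons_val_one, Matrix.cons_val]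
  ring

lemma poisson_add_left (m : E3 𝕜) (α β γ : E3 𝕜 →L[𝕜] ℂ) :
    poisson m (α + β) γ = poisson m α γ + poisson m β γ := by
  simp only [poisson_eq, add_apply]; ring

lemma poisson_smul_left (m : E3 𝕜) (c : ℂ) (α γ : E3 𝕜 →L[𝕜] ℂ) :
    poisson m (c • α) γ = c * poisson m α γ := by
  simp only [poisson_eq, smul_apply, smul_eq_mul]; ring

lemma poisson_swap (m : E3 𝕜) (α β : E3 𝕜 →L[𝕜] ℂ) : poisson m α β = -poisson m β α := by
  simp only [poisson_eq]; ring

lemma poisson_self (m : E3 𝕜) (α : E3 𝕜 →L[𝕜] ℂ) : poisson m α α = 0 := by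
  simp only [poisson_eq]; ring

lemma poisson_add_right (m : E3 𝕜) (α β γ : E3 𝕜 →L[𝕜] ℂ) :
    poisson m γ (α + β) = poisson m γ α + poisson m γ β := by
  simp only [poisson_eq, add_apply]; ring

lemma poisson_smul_right (m : E3 𝕜) (c : ℂ) (α γ : E3 𝕜 →L[𝕜] ℂ) :
    poisson m γ (c • α) = c * poisson m γ α := by
  simp only [poisson_eq, smul_apply, smul_eq_mul]; ring

/-- The covector with given components along the differentials of the coordinates. -/
def covec (a b : Fin 3 → ℂ) : E3 𝕜 →L[𝕜] ℂ := ∑ k, (a k • dx k + b k • dJ k)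

lemma covec_apply_x (a b : Fin 3 → ℂ) (k : Fin 3) :
    covec (𝕜 := 𝕜) a b (Pi.single k 1, 0) = a k := by
  fin_cases k <;> simp [covec, Fin.sum_univ_three]

lemma covec_apply_J (a b : Fin 3 → ℂ) (k : Fin 3) :
    covec (𝕜 := 𝕜) a b (0, Pi.single k 1) = b k := by
  fin_cases k <;> simp [covec, Fin.sum_univ_three]

end Covectors

section Gradients

variable {𝕜 : Type*} [NontriviallyNormedField 𝕜] [NormedAlgebra 𝕜 ℂ]

lemma hasFDerivAt_casA (m : E3 𝕜) :
    HasFDerivAt casA (covec ![2 * x 0 m, 2 * x 1 m, 2 * x 2 m] ![0, 0, 0]) m := by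
  have h := (((hasFDerivAt_x 0 m).pow 2).add ((hasFDerivAt_x 1 m).pow 2)).add
    ((hasFDerivAt_x 2 m).pow 2)
  have e : (casA : E3 𝕜 → ℂ) = x 0 ^ 2 + x 1 ^ 2 + x 2 ^ 2 := by
    funext n; simp [casA, Fin.sum_univ_three]
  rw [e]
  refine h.congr_fderiv ?_
  ext v <;> simp [covec, Fin.sum_univ_three]

lemma hasFDerivAt_casB (m : E3 𝕜) :
    HasFDerivAt casB (covec ![J 0 m, J 1 m, J 2 m] ![x 0 m, x 1 m, x 2 m]) m := by
  have h := (((hasFDerivAt_x 0 m).mul (hasFDerivAt_J 0 m)).add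
    ((hasFDerivAt_x 1 m).mul (hasFDerivAt_J 1 m))).add
    ((hasFDerivAt_x 2 m).mul (hasFDerivAt_J 2 m))
  have e : (casB : E3 𝕜 → ℂ) = x 0 * J 0 + x 1 * J 1 + x 2 * J 2 := by
    funext n; simp [casB, Fin.sum_univ_three]
  rw [e]
  refine h.congr_fderiv ?_
  ext v <;> simp [covec, Fin.sum_univ_three]

lemma hasFDerivAt_Jsq (m : E3 𝕜) :
    HasFDerivAt Jsq (covec ![0, 0, 0] ![2 * J 0 m, 2 * J 1 m, 2 * J 2 m]) m := by
  have h := (((hasFDerivAt_J 0 m).pow 2).add ((hasFDerivAt_J 1 m).pow 2)).add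
    ((hasFDerivAt_J 2 m).pow 2)
  have e : (Jsq : E3 𝕜 → ℂ) = J 0 ^ 2 + J 1 ^ 2 + J 2 ^ 2 := by
    funext n; simp [Jsq, Fin.sum_univ_three]
  rw [e]
  refine h.congr_fderiv ?_
  ext v <;> simp [covec, Fin.sum_univ_three]

lemma hasFDerivAt_Ham (c₁ c₂ : ℂ) (m : E3 𝕜) :
    HasFDerivAt (Ham c₁ c₂) (covec ![2 * c₁, 2 * c₂ * J 2 m, -2 * c₂ * J 1 m]
      ![2 * J 0 m, 2 * J 1 m - 2 * c₂ * x 2 m, 4 * J 2 m + 2 * c₂ * x 1 m]) m := by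
  have h := (((((hasFDerivAt_J 0 m).pow 2).add ((hasFDerivAt_J 1 m).pow 2)).add
    (((hasFDerivAt_J 2 m).pow 2).const_mul 2)).add ((hasFDerivAt_x 0 m).const_mul (2 * c₁))).add
    ((((hasFDerivAt_x 1 m).mul (hasFDerivAt_J 2 m)).sub
      ((hasFDerivAt_x 2 m).mul (hasFDerivAt_J 1 m))).const_mul (2 * c₂))
  refine h.congr_fderiv ?_
  ext v <;> simp [covec, Fin.sum_univ_three] <;> ring

lemma hasFDerivAt_z₁ (m : E3 𝕜) :
    HasFDerivAt z₁ (covec ![0, 0, 0] ![1, Complex.I, 0]) m := by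
  have h := (hasFDerivAt_J 0 m).add ((hasFDerivAt_J 1 m).const_mul Complex.I)
  refine h.congr_fderiv ?_
  ext v <;> simp [covec, Fin.sum_univ_three]

lemma hasFDerivAt_z₂ (m : E3 𝕜) :
    HasFDerivAt z₂ (covec ![0, 0, 0] ![1, -Complex.I, 0]) m := by
  have h := (hasFDerivAt_J 0 m).sub ((hasFDerivAt_J 1 m).const_mul Complex.I)
  refine h.congr_fderiv ?_
  ext v <;> simp [covec, Fin.sum_univ_three]
  ring

lemma bracket_Jsq_add (m : E3 𝕜) :
    bracket Jsq (fun n => x 0 n + Complex.I * x 1 n) m =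
      2 * (J 2 m * x 1 m - J 1 m * x 2 m) + 2 * Complex.I * (J 0 m * x 2 m - J 2 m * x 0 m) := by
  refine (bracket_eq_poisson (hasFDerivAt_Jsq m)
    ((hasFDerivAt_x 0 m).add ((hasFDerivAt_x 1 m).const_mul Complex.I))).trans ?_
  simp [poisson_eq, covec_apply_x, covec_apply_J]; ring

lemma bracket_Jsq_sub (m : E3 𝕜) :
    bracket Jsq (fun n => x 0 n - Complex.I * x 1 n) m =
      2 * (J 2 m * x 1 m - J 1 m * x 2 m) - 2 * Complex.I * (J 0 m * x 2 m - J 2 m * x 0 m) := by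
  refine (bracket_eq_poisson (hasFDerivAt_Jsq m)
    ((hasFDerivAt_x 0 m).sub ((hasFDerivAt_x 1 m).const_mul Complex.I))).trans ?_
  simp [poisson_eq, covec_apply_x, covec_apply_J]; ring

lemma xiHat_eq (c₁ c₂ : ℂ) (m : E3 𝕜) :
    xiHat c₁ c₂ m = z₁ m ^ 2 - 2 * c₁ * (x 0 m + Complex.I * x 1 m)
      - c₂ * (2 * (J 2 m * x 1 m - J 1 m * x 2 m)
        + 2 * Complex.I * (J 0 m * x 2 m - J 2 m * x 0 m)) - c₂ ^ 2 * casA m := by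
  rw [xiHat, bracket_Jsq_add]

lemma xiHatStar_eq (c₁ c₂ : ℂ) (m : E3 𝕜) :
    xiHatStar c₁ c₂ m = z₂ m ^ 2 - 2 * c₁ * (x 0 m - Complex.I * x 1 m)
      - c₂ * (2 * (J 2 m * x 1 m - J 1 m * x 2 m)
        - 2 * Complex.I * (J 0 m * x 2 m - J 2 m * x 0 m)) - c₂ ^ 2 * casA m := by
  rw [xiHatStar, bracket_Jsq_sub]

lemma hasFDerivAt_xiHat (c₁ c₂ : ℂ) (m : E3 𝕜) :
    HasFDerivAt (xiHat c₁ c₂) (covec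
      ![-2 * c₁ + 2 * c₂ * Complex.I * J 2 m - 2 * c₂ ^ 2 * x 0 m,
        -2 * c₁ * Complex.I - 2 * c₂ * J 2 m - 2 * c₂ ^ 2 * x 1 m,
        2 * c₂ * (J 1 m - Complex.I * J 0 m) - 2 * c₂ ^ 2 * x 2 m]
      ![2 * z₁ m - 2 * c₂ * Complex.I * x 2 m, 2 * Complex.I * z₁ m + 2 * c₂ * x 2 m,
        -2 * c₂ * (x 1 m - Complex.I * x 0 m)]) m := by
  have h := ((((hasFDerivAt_z₁ m).pow 2).sub (((hasFDerivAt_x 0 m).add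
    ((hasFDerivAt_x 1 m).const_mul Complex.I)).const_mul (2 * c₁))).sub
    ((((((hasFDerivAt_J 2 m).mul (hasFDerivAt_x 1 m)).sub
      ((hasFDerivAt_J 1 m).mul (hasFDerivAt_x 2 m))).const_mul 2).add
      ((((hasFDerivAt_J 0 m).mul (hasFDerivAt_x 2 m)).sub
      ((hasFDerivAt_J 2 m).mul (hasFDerivAt_x 0 m))).const_mul (2 * Complex.I))).const_mul c₂)).sub
    ((hasFDerivAt_casA m).const_mul (c₂ ^ 2))
  refine (h.congr_of_eventuallyEq (.of_forall fun n => xiHat_eq c₁ c₂ n)).congr_fderiv ?_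
  ext v <;> simp [covec, Fin.sum_univ_three] <;> ring

lemma hasFDerivAt_xiHatStar (c₁ c₂ : ℂ) (m : E3 𝕜) :
    HasFDerivAt (xiHatStar c₁ c₂) (covec
      ![-2 * c₁ - 2 * c₂ * Complex.I * J 2 m - 2 * c₂ ^ 2 * x 0 m,
        2 * c₁ * Complex.I - 2 * c₂ * J 2 m - 2 * c₂ ^ 2 * x 1 m,
        2 * c₂ * (J 1 m + Complex.I * J 0 m) - 2 * c₂ ^ 2 * x 2 m]
      ![2 * z₂ m + 2 * c₂ * Complex.I * x 2 m, -2 * Complex.I * z₂ m + 2 * c₂ * x 2 m,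
        -2 * c₂ * (x 1 m + Complex.I * x 0 m)]) m := by
  have h := ((((hasFDerivAt_z₂ m).pow 2).sub (((hasFDerivAt_x 0 m).sub
    ((hasFDerivAt_x 1 m).const_mul Complex.I)).const_mul (2 * c₁))).sub
    ((((((hasFDerivAt_J 2 m).mul (hasFDerivAt_x 1 m)).sub
      ((hasFDerivAt_J 1 m).mul (hasFDerivAt_x 2 m))).const_mul 2).sub
      ((((hasFDerivAt_J 0 m).mul (hasFDerivAt_x 2 m)).sub
      ((hasFDerivAt_J 2 m).mul (hasFDerivAt_x 0 m))).const_mul (2 * Complex.I))).const_mul c₂)).sub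
    ((hasFDerivAt_casA m).const_mul (c₂ ^ 2))
  refine (h.congr_of_eventuallyEq (.of_forall fun n => xiHatStar_eq c₁ c₂ n)).congr_fderiv ?_
  ext v <;> simp [covec, Fin.sum_univ_three] <;> ring

end Gradients

/-! ### Brackets of the basic functions -/

section Integrals

variable {𝕜 : Type*} [NontriviallyNormedField 𝕜] [NormedAlgebra 𝕜 ℂ]

lemma poisson_fderiv (f g : E3 𝕜 → ℂ) (m : E3 𝕜) :
    poisson m (fderiv 𝕜 f m) (fderiv 𝕜 g m) = bracket f g m := rfl

lemma bracket_swap (f g : E3 𝕜 → ℂ) (m : E3 𝕜) : bracket f g m = -bracket g f m :=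
  poisson_swap m _ _

lemma poisson_casA (m : E3 𝕜) (γ : E3 𝕜 →L[𝕜] ℂ) : poisson m γ (fderiv 𝕜 casA m) = 0 := by
  rw [(hasFDerivAt_casA m).fderiv]
  simp [poisson_eq, covec_apply_x, covec_apply_J]; ring

lemma poisson_casB (m : E3 𝕜) (γ : E3 𝕜 →L[𝕜] ℂ) : poisson m γ (fderiv 𝕜 casB m) = 0 := by
  rw [(hasFDerivAt_casB m).fderiv]
  simp [poisson_eq, covec_apply_x, covec_apply_J]; ring

lemma bracket_casA (f : E3 𝕜 → ℂ) (m : E3 𝕜) : bracket f casA m = 0 := poisson_casA m _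

lemma bracket_casB (f : E3 𝕜 → ℂ) (m : E3 𝕜) : bracket f casB m = 0 := poisson_casB m _

lemma bracket_Ham_z₁ (c₁ c₂ : ℂ) (m : E3 𝕜) :
    bracket (Ham c₁ c₂) z₁ m = -2 * Complex.I *
      (J 2 m * z₁ m - c₁ * x 2 m - c₂ * (x 0 m * J 1 m - x 1 m * J 0 m)) := by
  rw [bracket_eq_poisson (hasFDerivAt_Ham c₁ c₂ m) (hasFDerivAt_z₁ m)]
  simp [poisson_eq, covec_apply_x, covec_apply_J, z₁]
  linear_combination (2 * J 1 m * J 2 m) * Complex.I_sq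

lemma bracket_Ham_z₂ (c₁ c₂ : ℂ) (m : E3 𝕜) :
    bracket (Ham c₁ c₂) z₂ m = 2 * Complex.I *
      (J 2 m * z₂ m - c₁ * x 2 m - c₂ * (x 0 m * J 1 m - x 1 m * J 0 m)) := by
  rw [bracket_eq_poisson (hasFDerivAt_Ham c₁ c₂ m) (hasFDerivAt_z₂ m)]
  simp [poisson_eq, covec_apply_x, covec_apply_J, z₂]
  linear_combination (2 * J 1 m * J 2 m) * Complex.I_sq

lemma bracket_Ham_xiHat (c₁ c₂ : ℂ) (m : E3 𝕜) :
    bracket (Ham c₁ c₂) (xiHat c₁ c₂) m = -4 * Complex.I * J 2 m * xiHat c₁ c₂ m := by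
  rw [bracket_eq_poisson (hasFDerivAt_Ham c₁ c₂ m) (hasFDerivAt_xiHat c₁ c₂ m), xiHat_eq]
  simp [poisson_eq, covec_apply_x, covec_apply_J, z₁, casA, Fin.sum_univ_three]
  ring_nf
  simp only [Complex.I_sq, Complex.I_pow_three]
  ring_nf

/-- `ξ̂` commutes with `z₁` and, up to the factor two, moves `z₂` along the Hamiltonian velocity of
`z₁`; with the conjugate statements this makes the flow of `K̂` explicit on `z₁, z₂`. -/
lemma bracket_xiHat_z₁ (c₁ c₂ : ℂ) (m : E3 𝕜) : bracket (xiHat c₁ c₂) z₁ m = 0 := by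
  rw [bracket_eq_poisson (hasFDerivAt_xiHat c₁ c₂ m) (hasFDerivAt_z₁ m)]
  simp [poisson_eq, covec_apply_x, covec_apply_J, z₁]
  ring

lemma bracket_xiHat_z₂ (c₁ c₂ : ℂ) (m : E3 𝕜) :
    bracket (xiHat c₁ c₂) z₂ m = 2 * bracket (Ham c₁ c₂) z₁ m := by
  rw [bracket_eq_poisson (hasFDerivAt_xiHat c₁ c₂ m) (hasFDerivAt_z₂ m), bracket_Ham_z₁]
  simp [poisson_eq, covec_apply_x, covec_apply_J, z₁]
  ring

lemma bracket_Ham_z₁_sq (c₁ c₂ : ℂ) (m : E3 𝕜) :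
    bracket (Ham c₁ c₂) z₁ m ^ 2 = F c₁ c₂ m (z₁ m) - xiHat c₁ c₂ m * (z₁ m - z₂ m) ^ 2 := by
  rw [bracket_Ham_z₁, F, Kint, xiHat_eq, xiHatStar_eq]
  simp only [casA, casB, Fin.sum_univ_three, Ham, z₁, z₂]
  ring_nf
  simp only [Complex.I_sq, Complex.I_pow_three, Complex.I_pow_four]
  ring_nf

lemma bracket_Ham_xiHatStar (c₁ c₂ : ℂ) (m : E3 𝕜) :
    bracket (Ham c₁ c₂) (xiHatStar c₁ c₂) m = 4 * Complex.I * J 2 m * xiHatStar c₁ c₂ m := by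
  rw [bracket_eq_poisson (hasFDerivAt_Ham c₁ c₂ m) (hasFDerivAt_xiHatStar c₁ c₂ m), xiHatStar_eq]
  simp [poisson_eq, covec_apply_x, covec_apply_J, z₂, casA, Fin.sum_univ_three]
  ring_nf
  simp only [Complex.I_sq, Complex.I_pow_three]
  ring_nf

lemma bracket_xiHatStar_z₂ (c₁ c₂ : ℂ) (m : E3 𝕜) : bracket (xiHatStar c₁ c₂) z₂ m = 0 := by
  rw [bracket_eq_poisson (hasFDerivAt_xiHatStar c₁ c₂ m) (hasFDerivAt_z₂ m)]
  simp [poisson_eq, covec_apply_x, covec_apply_J, z₂]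
  ring

lemma bracket_xiHatStar_z₁ (c₁ c₂ : ℂ) (m : E3 𝕜) :
    bracket (xiHatStar c₁ c₂) z₁ m = 2 * bracket (Ham c₁ c₂) z₂ m := by
  rw [bracket_eq_poisson (hasFDerivAt_xiHatStar c₁ c₂ m) (hasFDerivAt_z₁ m), bracket_Ham_z₂]
  simp [poisson_eq, covec_apply_x, covec_apply_J, z₂]
  ring

lemma bracket_Ham_z₂_sq (c₁ c₂ : ℂ) (m : E3 𝕜) :
    bracket (Ham c₁ c₂) z₂ m ^ 2 = F c₁ c₂ m (z₂ m) - xiHatStar c₁ c₂ m * (z₁ m - z₂ m) ^ 2 := by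
  rw [bracket_Ham_z₂, F, Kint, xiHat_eq, xiHatStar_eq]
  simp only [casA, casB, Fin.sum_univ_three, Ham, z₁, z₂]
  ring_nf
  simp only [Complex.I_sq, Complex.I_pow_three, Complex.I_pow_four]
  ring_nf

/-- The sum of the velocities determines `{z₁, z₂}`; this is what makes the separation variables
commute. -/
lemma bracket_z₁_z₂ (c₁ c₂ : ℂ) (m : E3 𝕜) :
    (z₁ m - z₂ m) * bracket z₁ z₂ m = bracket (Ham c₁ c₂) z₁ m + bracket (Ham c₁ c₂) z₂ m := by
  rw [bracket_eq_poisson (hasFDerivAt_z₁ m) (hasFDerivAt_z₂ m), bracket_Ham_z₁, bracket_Ham_z₂]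
  simp [poisson_eq, covec_apply_x, covec_apply_J, z₁, z₂]
  ring

/-- The product of the velocities is polynomial in `z₁, z₂` and the integrals.  It fixes the relative
sign of the square roots `ż₁, ż₂`, which their squares alone leave open. -/
lemma bracket_Ham_z₁_mul_bracket_Ham_z₂ (c₁ c₂ : ℂ) (m : E3 𝕜) :
    bracket (Ham c₁ c₂) z₁ m * bracket (Ham c₁ c₂) z₂ m =
      -(F₂ c₁ c₂ m + (z₁ m - z₂ m) ^ 2 * (Ham c₁ c₂ m + c₂ ^ 2 * casA m)) := by
  rw [bracket_Ham_z₁, bracket_Ham_z₂, F₂, F, F, Kint, xiHat_eq, xiHatStar_eq]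
  simp only [casA, casB, Fin.sum_univ_three, Ham, z₁, z₂]
  ring_nf
  simp only [Complex.I_sq, Complex.I_pow_four]
  ring_nf

lemma hasFDerivAt_Kint (c₁ c₂ : ℂ) (m : E3 𝕜) :
    HasFDerivAt (Kint c₁ c₂) (xiHat c₁ c₂ m • fderiv 𝕜 (xiHatStar c₁ c₂) m
      + xiHatStar c₁ c₂ m • fderiv 𝕜 (xiHat c₁ c₂) m) m :=
  (hasFDerivAt_xiHat c₁ c₂ m).differentiableAt.hasFDerivAt.mul
    (hasFDerivAt_xiHatStar c₁ c₂ m).differentiableAt.hasFDerivAt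

lemma bracket_Ham_Kint (c₁ c₂ : ℂ) (m : E3 𝕜) : bracket (Ham c₁ c₂) (Kint c₁ c₂) m = 0 := by
  have h : bracket (Ham c₁ c₂) (Kint c₁ c₂) m =
      xiHat c₁ c₂ m * bracket (Ham c₁ c₂) (xiHatStar c₁ c₂) m
        + xiHatStar c₁ c₂ m * bracket (Ham c₁ c₂) (xiHat c₁ c₂) m := by
    rw [bracket_eq_poisson (hasFDerivAt_Ham c₁ c₂ m).differentiableAt.hasFDerivAt
      (hasFDerivAt_Kint c₁ c₂ m), poisson_add_right, poisson_smul_right, poisson_smul_right]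
    rfl
  rw [h, bracket_Ham_xiHat, bracket_Ham_xiHatStar]
  ring

lemma bracket_Kint (c₁ c₂ : ℂ) (f : E3 𝕜 → ℂ) (m : E3 𝕜) (hf : DifferentiableAt 𝕜 f m) :
    bracket (Kint c₁ c₂) f m = xiHat c₁ c₂ m * bracket (xiHatStar c₁ c₂) f m
        + xiHatStar c₁ c₂ m * bracket (xiHat c₁ c₂) f m := by
  rw [bracket_eq_poisson (hasFDerivAt_Kint c₁ c₂ m) hf.hasFDerivAt, poisson_add_left,
    poisson_smul_left, poisson_smul_left]
  rfl

lemma bracket_Kint_z₁ (c₁ c₂ : ℂ) (m : E3 𝕜) :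
    bracket (Kint c₁ c₂) z₁ m = 2 * xiHat c₁ c₂ m * bracket (Ham c₁ c₂) z₂ m := by
  rw [bracket_Kint _ _ _ _ (hasFDerivAt_z₁ m).differentiableAt, bracket_xiHat_z₁,
    bracket_xiHatStar_z₁]
  ring

lemma bracket_Kint_z₂ (c₁ c₂ : ℂ) (m : E3 𝕜) :
    bracket (Kint c₁ c₂) z₂ m = 2 * xiHatStar c₁ c₂ m * bracket (Ham c₁ c₂) z₁ m := by
  rw [bracket_Kint _ _ _ _ (hasFDerivAt_z₂ m).differentiableAt, bracket_xiHat_z₂,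
    bracket_xiHatStar_z₂]
  ring

end Integrals

/-! ### Roots attached to a quartic and its resolvent cubic -/

section Resolvent

/-- The quartic `z⁴ - 2 H z² + 2 e z + k`. -/
def quart (H e k z : ℂ) : ℂ := z ^ 4 - 2 * H * z ^ 2 + 2 * e * z + k

/-- The symmetric biquadratic polarization of `quart`. -/
def quartPolar (H e k a b : ℂ) : ℂ := a ^ 2 * b ^ 2 - H * (a ^ 2 + b ^ 2) + e * (a + b) + k

/-- The covariant `½ (a - b) ∂ₐ f(a) - 2 f(a)` of the quartic `f = quart H e k`. -/
def quartCov (H e k a b : ℂ) : ℂ :=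
  -2 * a ^ 3 * b + 2 * H * a * b + 2 * H * a ^ 2 - 3 * e * a - e * b - 2 * k

/-- The resolvent cubic of `quart H e k`. -/
def resolvent (H e k s : ℂ) : ℂ := s * (4 * s ^ 2 + 4 * s * H + H ^ 2 - k) + e ^ 2 / 4

/-- The root `(Φ + r) / (2 (a - b)²)`. -/
def rootS (H e k a b r : ℂ) : ℂ := (quartPolar H e k a b + r) / (2 * (a - b) ^ 2)

/-- The partial derivative of `rootS` with respect to `a`, for `r = √(f(a) f(b))`.  The one with
respect to `b` is obtained by exchanging `a` and `b`. -/
def rootSa (H e k a b r : ℂ) : ℂ :=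
  (quartCov H e k a b * quart H e k b + quartCov H e k b a * r) / (2 * (a - b) ^ 3 * r)

/-- The partial derivative of `rootS` with respect to `H`. -/
def rootSH (H e k a b r : ℂ) : ℂ :=
  (-(a ^ 2 + b ^ 2) - (quart H e k a * b ^ 2 + quart H e k b * a ^ 2) / r) / (2 * (a - b) ^ 2)

/-- The partial derivative of `rootS` with respect to `e`. -/
def rootSe (H e k a b r : ℂ) : ℂ :=
  (a + b + (a * quart H e k b + b * quart H e k a) / r) / (2 * (a - b) ^ 2)

/-- The partial derivative of `rootS` with respect to `k`. -/
def rootSk (H e k a b r : ℂ) : ℂ :=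
  (1 + (quart H e k a + quart H e k b) / (2 * r)) / (2 * (a - b) ^ 2)

variable {H e k a b r : ℂ}

/-- The root is a solution of Euler's equation: its two partial derivatives have ratio
`-√f(a) : √f(b)`. -/
lemma rootSa_swap (hr : r ≠ 0) (h : r ^ 2 = quart H e k a * quart H e k b) (hab : a - b ≠ 0) :
    rootSa H e k b a r = -(quart H e k a / r * rootSa H e k a b r) := by
  have hba : b - a = -(a - b) := by ring
  rw [rootSa, rootSa, hba]
  generalize quartCov H e k a b = N at *
  generalize quartCov H e k b a = M at *
  generalize quart H e k a = A at *
  generalize quart H e k b = B at *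
  field_simp
  linear_combination -N * h

/-- The square of the partial derivative of the root: `(∂ₐ s)² f(a)` is the resolvent cubic at `s`. -/
lemma rootSa_sq (hr : r ≠ 0) (h : r ^ 2 = quart H e k a * quart H e k b) (hab : a - b ≠ 0) :
    rootSa H e k a b r ^ 2 * quart H e k a = resolvent H e k (rootS H e k a b r) := by
  have key : quartCov H e k a b ^ 2 * quart H e k b
      + 2 * quartCov H e k a b * quartCov H e k b a * r
      + quartCov H e k b a ^ 2 * quart H e k a
      = 2 * (quartPolar H e k a b + r) ^ 3
        + 4 * H * (a - b) ^ 2 * (quartPolar H e k a b + r) ^ 2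
        + 2 * (a - b) ^ 4 * (H ^ 2 - k) * (quartPolar H e k a b + r) + e ^ 2 * (a - b) ^ 6 := by
    have h2 := h
    simp only [quartCov, quart, quartPolar] at h2 ⊢
    -- the multiplier is the quotient of the right-hand side by `r ^ 2 - f(a) f(b)`
    linear_combination (-(6 * (a ^ 2 * b ^ 2 - H * (a ^ 2 + b ^ 2) + e * (a + b) + k) + 2 * r
      + 4 * H * (a - b) ^ 2)) * h2
  have e1 : rootSa H e k a b r ^ 2 * quart H e k a =
      (quartCov H e k a b ^ 2 * quart H e k b
      + 2 * quartCov H e k a b * quartCov H e k b a * r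
      + quartCov H e k b a ^ 2 * quart H e k a) / (4 * (a - b) ^ 6) := by
    rw [rootSa]
    generalize quartCov H e k a b = N at *
    generalize quartCov H e k b a = M at *
    generalize quart H e k a = A at *
    generalize quart H e k b = B at *
    field_simp
    linear_combination (-4 * (N ^ 2 * B + 2 * N * M * r)) * h
  rw [e1, key, resolvent, rootS]
  field_simp
  ring

/-- The derivative of the root along `∂_H + 2 (2 s + H) ∂_k` is a multiple of the one along `∂ₐ`.
This direction occurs because the flows of `Ĥ` and `K̂` move a root with velocities in the ratio
`1 : 2 (2 s + Ĥ + c₂² A)`, `s` being the other root. -/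
lemma rootSH_add (hr : r ≠ 0) (h : r ^ 2 = quart H e k a * quart H e k b) (hab : a - b ≠ 0) :
    rootSH H e k a b r + 2 * (2 * rootS H e k a b r + H) * rootSk H e k a b r
      = -(rootSa H e k a b r * (quart H e k a + r) / ((a - b) * r)) := by
  have key : (a - b) ^ 2 * (-(a ^ 2 + b ^ 2) * r - (quart H e k a * b ^ 2 + quart H e k b * a ^ 2))
      + (2 * quartPolar H e k a b + 2 * r + 2 * H * (a - b) ^ 2)
        * (r + (quart H e k a + quart H e k b) / 2)
      + (quartCov H e k a b * r + quartCov H e k a b * quart H e k b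
        + quartCov H e k b a * quart H e k a + quartCov H e k b a * r) = 0 := by
    have h2 := h
    simp only [quartCov, quart, quartPolar] at h2 ⊢
    linear_combination 2 * h2
  rw [rootSH, rootSk, rootSa, rootS]
  generalize quartCov H e k a b = N at *
  generalize quartCov H e k b a = M at *
  generalize quart H e k a = A at *
  generalize quart H e k b = B at *
  generalize quartPolar H e k a b = Φ at *
  field_simp
  linear_combination r * key - N * h

end Resolvent

/-! ### Differentials of the roots and of the momenta -/

section Differential

variable {𝕜 E : Type*} [NontriviallyNormedField 𝕜] [NormedAlgebra 𝕜 ℂ] [NormedAddCommGroup E]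
  [NormedSpace 𝕜 E] {H e k a b r : E → ℂ} {H' e' k' a' b' : E →L[𝕜] ℂ} {m : E}

lemma hasFDerivAt_quart (hH : HasFDerivAt H H' m) (he : HasFDerivAt e e' m)
    (hk : HasFDerivAt k k' m) (ha : HasFDerivAt a a' m) :
    HasFDerivAt (fun n => quart (H n) (e n) (k n) (a n))
      ((4 * a m ^ 3 - 4 * H m * a m + 2 * e m) • a' - (2 * a m ^ 2) • H' + (2 * a m) • e' + k')
      m := by
  have h := (((ha.pow 4).sub ((hH.const_mul 2).mul (ha.pow 2))).add
    ((he.const_mul 2).mul ha)).add hk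
  refine h.congr_fderiv ?_
  ext v
  simp
  ring

lemma hasFDerivAt_quartPolar (hH : HasFDerivAt H H' m) (he : HasFDerivAt e e' m)
    (hk : HasFDerivAt k k' m) (ha : HasFDerivAt a a' m) (hb : HasFDerivAt b b' m) :
    HasFDerivAt (fun n => quartPolar (H n) (e n) (k n) (a n) (b n))
      ((2 * a m * b m ^ 2 - 2 * H m * a m + e m) • a'
        + (2 * b m * a m ^ 2 - 2 * H m * b m + e m) • b'
        - (a m ^ 2 + b m ^ 2) • H' + (a m + b m) • e' + k') m := by
  have h := ((((ha.pow 2).mul (hb.pow 2)).sub (hH.mul ((ha.pow 2).add (hb.pow 2)))).add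
    (he.mul (ha.add hb))).add hk
  refine h.congr_fderiv ?_
  ext v
  simp
  ring

/-- The differential of the root for varying coefficients and arguments of the quartic.  It is found
by differentiating the two relations `r² = f(a) f(b)` and `2 (a - b)² s = Φ + r`. -/
lemma hasFDerivAt_rootS (hH : HasFDerivAt H H' m) (he : HasFDerivAt e e' m)
    (hk : HasFDerivAt k k' m) (ha : HasFDerivAt a a' m) (hb : HasFDerivAt b b' m)
    (hr : DifferentiableAt 𝕜 r m)
    (h : ∀ᶠ n in nhds m, r n ^ 2 =
      quart (H n) (e n) (k n) (a n) * quart (H n) (e n) (k n) (b n))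
    (hr0 : r m ≠ 0) (hab : a m - b m ≠ 0) :
    HasFDerivAt (fun n => rootS (H n) (e n) (k n) (a n) (b n) (r n))
      (rootSa (H m) (e m) (k m) (a m) (b m) (r m) • a'
        + rootSa (H m) (e m) (k m) (b m) (a m) (r m) • b'
        + rootSH (H m) (e m) (k m) (a m) (b m) (r m) • H'
        + rootSe (H m) (e m) (k m) (a m) (b m) (r m) • e'
        + rootSk (H m) (e m) (k m) (a m) (b m) (r m) • k') m := by
  have hd : DifferentiableAt 𝕜 (fun n => rootS (H n) (e n) (k n) (a n) (b n) (r n)) m := by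
    have h1 := (hasFDerivAt_quartPolar hH he hk ha hb).differentiableAt
    have h2 := ha.differentiableAt
    have h3 := hb.differentiableAt
    unfold rootS
    simp only [div_eq_mul_inv]
    refine (h1.add hr).mul (DifferentiableAt.inv ?_ (by simpa using hab))
    fun_prop
  refine hd.hasFDerivAt.congr_fderiv ?_
  set S' := fderiv 𝕜 (fun n => rootS (H n) (e n) (k n) (a n) (b n) (r n)) m with hS
  have hsq := (hr.hasFDerivAt.pow 2).unique
    (((hasFDerivAt_quart hH he hk ha).mul (hasFDerivAt_quart hH he hk hb)).congr_of_eventuallyEq h)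
  have hab' : ∀ᶠ n in nhds m, a n - b n ≠ 0 :=
    (ha.continuousAt.sub hb.continuousAt).eventually_ne hab
  have hlin := ((((ha.sub hb).pow 2).const_mul 2).mul hd.hasFDerivAt).unique
    (((hasFDerivAt_quartPolar hH he hk ha hb).add hr.hasFDerivAt).congr_of_eventuallyEq (by
      filter_upwards [hab'] with n hn
      simp only [Pi.mul_apply, Pi.add_apply, Pi.sub_apply, rootS]
      field_simp))
  ext v
  have e1 := DFunLike.congr_fun hsq v
  have e2 := DFunLike.congr_fun hlin v
  have e0 := h.self_of_nhds
  rw [← hS] at e2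
  simp at e1 e2 ⊢
  generalize S' v = s' at *
  generalize fderiv 𝕜 r m v = r' at *
  generalize a' v = a' at *
  generalize b' v = b' at *
  generalize H' v = H' at *
  generalize e' v = e' at *
  generalize k' v = k' at *
  generalize a m = a at *
  generalize b m = b at *
  generalize H m = H at *
  generalize e m = e at *
  generalize k m = k at *
  generalize r m = r at *
  clear hsq hlin hab'
  -- the second relation, with `s` eliminated
  have e3 : 2 * (a - b) ^ 3 * s' + 2 * (quartPolar H e k a b + r) * (a' - b') =
      (a - b) * ((2 * a * b ^ 2 - 2 * H * a + e) * a' + (2 * b * a ^ 2 - 2 * H * b + e) * b'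
        - (a ^ 2 + b ^ 2) * H' + (a + b) * e' + k' + r') := by
    rw [← e2, rootS]
    field_simp
  have e4 : 2 * (a - b) ^ 3 * r * (rootSa H e k a b r * a' + rootSa H e k b a r * b'
      + rootSH H e k a b r * H' + rootSe H e k a b r * e' + rootSk H e k a b r * k') =
      (quartCov H e k a b * quart H e k b + quartCov H e k b a * r) * a'
      - (quartCov H e k b a * quart H e k a + quartCov H e k a b * r) * b'
      + (a - b) * ((-(a ^ 2 + b ^ 2) * r - (quart H e k a * b ^ 2 + quart H e k b * a ^ 2)) * H'
        + ((a + b) * r + a * quart H e k b + b * quart H e k a) * e'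
        + (r + (quart H e k a + quart H e k b) / 2) * k') := by
    have hba : b - a = -(a - b) := by ring
    rw [rootSa, rootSa, rootSH, rootSe, rootSk, hba]
    field_simp
    ring
  have hD : 2 * (a - b) ^ 3 * r ≠ 0 := mul_ne_zero (mul_ne_zero two_ne_zero (pow_ne_zero 3 hab)) hr0
  refine mul_left_cancel₀ hD ?_
  rw [e4]
  simp only [quart, quartCov, quartPolar] at e0 e1 e3 ⊢
  linear_combination r * e3 + (a - b) / 2 * e1 - 2 * (a' - b') * e0

/-- A continuous branch of the inverse of an analytic function is smooth along smooth functions. -/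
lemma contDiffAt_of_comp {g : E → ℂ} {φ : ℂ → ℂ} {c : ℂ} (hg : ContinuousAt g m)
    (hφ : ContDiffAt ℂ ∞ φ (g m)) (hc : HasDerivAt φ c (g m)) (hc0 : c ≠ 0)
    (h : ContDiffAt 𝕜 ∞ (fun n => φ (g n)) m) : ContDiffAt 𝕜 ∞ g m := by
  have hf := hc.hasFDerivAt_equiv hc0
  have hn : (∞ : WithTop ℕ∞) ≠ 0 := by simp
  have h1 := (hφ.to_localInverse hf hn).restrict_scalars 𝕜
  refine (h1.comp m h).congr_of_eventuallyEq ?_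
  filter_upwards [hg.eventually (hφ.hasStrictFDerivAt' hf hn).eventually_left_inverse] with n hn
  exact hn.symm

/-- The sum `P₃(s) + s P₂(s)` as a polynomial in `s` and the integrals `H, K, A, B`. -/
def momNum (c₁ c₂ s H K A B : ℂ) : ℂ :=
  8 * s ^ 3 + 4 * (2 * H + c₂ ^ 2 * A) * s ^ 2
    + 2 * s * ((H + c₂ ^ 2 * A) ^ 2 - K + 2 * c₁ ^ 2 * A - 2 * c₂ ^ 2 * B ^ 2)
    + 4 * c₁ ^ 2 * B ^ 2

/-- The differential of the momentum along the level sets of the Casimir functions.  The momentum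
is `p = ℓ / (4 ρ)`, where `cosh ℓ` is a rational function of `s` and the integrals. -/
lemma exists_hasFDerivAt_momentum (c₁ c₂ : ℂ) {s K A B ρ ℓ : E → ℂ} {q : ℂ}
    {s' K' A' B' : E →L[𝕜] ℂ} (hs : HasFDerivAt s s' m) (hH : HasFDerivAt H H' m)
    (hK : HasFDerivAt K K' m) (hA : HasFDerivAt A A' m) (hB : HasFDerivAt B B' m)
    (hρ : DifferentiableAt 𝕜 ρ m) (hℓ : DifferentiableAt 𝕜 ℓ m)
    (hρs : ∀ᶠ n in nhds m, ρ n ^ 2 = s n)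
    (hcosh : ∀ᶠ n in nhds m,
      Complex.cosh (ℓ n) * (4 * (A n * s n + B n ^ 2) * (c₁ ^ 2 - c₂ ^ 2 * s n))
        = -momNum c₁ c₂ (s n) (H n) (K n) (A n) (B n))
    (hsinh : Complex.sinh (ℓ m) * (4 * (A m * s m + B m ^ 2) * (c₁ ^ 2 - c₂ ^ 2 * s m))
      = 2 * (ρ m * q)) (hρ0 : ρ m ≠ 0) (hq : q ≠ 0) :
    ∃ u α β : ℂ, HasFDerivAt (fun n => 1 / (4 * ρ n) * ℓ n)
      (u • s' + (-(2 * s m + H m + c₂ ^ 2 * A m) / (2 * q)) • H' + (1 / (4 * q)) • K'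
        + α • A' + β • B') m := by
  have hN := ((((hA.mul hs).add (hB.pow 2)).const_mul 4).mul ((hs.const_mul (c₂ ^ 2)).const_sub
    (c₁ ^ 2)))
  have hM : HasFDerivAt (fun n => -momNum c₁ c₂ (s n) (H n) (K n) (A n) (B n)) _ m :=
    ((((((hs.pow 3).const_mul 8).add ((((hH.const_mul 2).add (hA.const_mul (c₂ ^ 2))).const_mul
      4).mul (hs.pow 2))).add ((hs.const_mul 2).mul ((((((hH.add (hA.const_mul
      (c₂ ^ 2))).pow 2).sub hK).add (hA.const_mul (2 * c₁ ^ 2))).sub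
      ((hB.pow 2).const_mul (2 * c₂ ^ 2)))))).add ((hB.pow 2).const_mul (4 * c₁ ^ 2)))).neg
  have hc := (((Complex.hasDerivAt_cosh (ℓ m)).comp_hasFDerivAt m hℓ.hasFDerivAt).mul hN).unique
    (hM.congr_of_eventuallyEq hcosh)
  have hr := (hρ.hasFDerivAt.pow 2).unique (hs.congr_of_eventuallyEq hρs)
  have hd : DifferentiableAt 𝕜 (fun n => 1 / (4 * ρ n) * ℓ n) m := by
    simp only [one_div]
    exact ((hρ.const_mul 4).inv (by simpa using hρ0)).mul hℓ
  have hp := ((hρ.hasFDerivAt.const_mul 4).mul hd.hasFDerivAt).unique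
    (hℓ.hasFDerivAt.congr_of_eventuallyEq (by
      filter_upwards [hρ.continuousAt.eventually_ne hρ0] with n hn
      simp only [Pi.mul_apply]
      field_simp))
  refine ⟨(-(24 * s m ^ 2 + 8 * (2 * H m + c₂ ^ 2 * A m) * s m + 2 * ((H m + c₂ ^ 2 * A m) ^ 2
      - K m + 2 * c₁ ^ 2 * A m - 2 * c₂ ^ 2 * B m ^ 2))
      - Complex.cosh (ℓ m) * (4 * A m * (c₁ ^ 2 - c₂ ^ 2 * s m)
        - 4 * c₂ ^ 2 * (A m * s m + B m ^ 2))) / (8 * s m * q) - ℓ m / (8 * ρ m * s m),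
    (-(4 * c₂ ^ 2 * s m ^ 2 + 4 * s m * (c₂ ^ 2 * (H m + c₂ ^ 2 * A m) + c₁ ^ 2))
      - Complex.cosh (ℓ m) * (4 * s m * (c₁ ^ 2 - c₂ ^ 2 * s m))) / (8 * s m * q),
    (-(8 * c₁ ^ 2 * B m - 8 * c₂ ^ 2 * s m * B m)
      - Complex.cosh (ℓ m) * (8 * B m * (c₁ ^ 2 - c₂ ^ 2 * s m))) / (8 * s m * q),
    hd.hasFDerivAt.congr_fderiv ?_⟩
  ext v
  have e1 := DFunLike.congr_fun hc v
  have e2 := DFunLike.congr_fun hr v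
  have e3 := DFunLike.congr_fun hp v
  have e0 := hρs.self_of_nhds
  generalize fderiv 𝕜 (fun n => 1 / (4 * ρ n) * ℓ n) m = p' at *
  simp at e1 e2 e3 ⊢
  rw [← e0] at e1 hsinh ⊢
  rw [← e2] at e1 ⊢
  generalize p' v = p' at *
  generalize fderiv 𝕜 ρ m v = ρ' at *
  generalize fderiv 𝕜 ℓ m v = ℓ' at *
  field_simp at e3
  field_simp
  linear_combination 16 * q * e3 - 8 * ℓ' * hsinh + 8 * e1

end Differential

/-! ### The two flows on a root, and smoothness of the basic functions -/

section Flows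

variable {H e k a b r f g ξ η h : ℂ}

lemma rootS_sub_rootS_neg (hab : a - b ≠ 0) :
    rootS H e k a b r - rootS H e k a b (-r) = r / (a - b) ^ 2 := by
  rw [rootS, rootS]
  field_simp
  ring

/-- The square of the velocity of the root, scaled by the difference `r / (a - b)²` of the two roots,
is the product of the resolvent cubic and a quadratic polynomial. -/
lemma velocity_sq (hr : r ≠ 0) (h2 : r ^ 2 = quart H e k a * quart H e k b) (hab : a - b ≠ 0)
    (hf : f ^ 2 = quart H e k a - ξ * (a - b) ^ 2) (hg : g ^ 2 = quart H e k b - η * (a - b) ^ 2)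
    (hfg : f * g = -(quartPolar H e k a b + (a - b) ^ 2 * h)) :
    (r / (a - b) ^ 2 * (rootSa H e k a b r * f + rootSa H e k b a r * g)) ^ 2
      = resolvent H e k (rootS H e k a b r)
        * ((2 * rootS H e k a b r + h) ^ 2 - ξ * η) := by
  rw [rootSa_swap hr h2 hab, ← rootSa_sq hr h2 hab]
  have h3 : (2 * rootS H e k a b r + h) ^ 2 - ξ * η =
      (quart H e k b * f ^ 2 - 2 * r * (f * g) + quart H e k a * g ^ 2) / (a - b) ^ 4 := by
    have h4 : 2 * rootS H e k a b r + h = (r - f * g) / (a - b) ^ 2 := by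
      rw [hfg, rootS]; field_simp; ring
    have h5 : ξ = (quart H e k a - f ^ 2) / (a - b) ^ 2 := by rw [hf]; field_simp; ring
    have h6 : η = (quart H e k b - g ^ 2) / (a - b) ^ 2 := by rw [hg]; field_simp; ring
    rw [h4, h5, h6]
    field_simp
    linear_combination h2
  rw [h3]
  generalize quart H e k a = A at *
  generalize quart H e k b = B at *
  generalize rootSa H e k a b r = u at *
  field_simp
  linear_combination u ^ 2 * f ^ 2 * h2

/-- The velocities `2 ξ g, 2 η f` of `a, b` move the root at the same rate as the velocities `f, g`, up
to a factor that depends on the opposite root only. -/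
lemma second_velocity (hr : r ≠ 0) (h2 : r ^ 2 = quart H e k a * quart H e k b) (hab : a - b ≠ 0)
    (hf : f ^ 2 = quart H e k a - ξ * (a - b) ^ 2) (hg : g ^ 2 = quart H e k b - η * (a - b) ^ 2)
    (hfg : f * g = -(quartPolar H e k a b + (a - b) ^ 2 * h)) :
    rootSa H e k a b r * (2 * ξ * g) + rootSa H e k b a r * (2 * η * f)
      = 2 * (2 * rootS H e k a b (-r) + h)
        * (rootSa H e k a b r * f + rootSa H e k b a r * g) := by
  rw [rootSa_swap hr h2 hab]
  have h4 : 2 * rootS H e k a b (-r) + h = -(r + f * g) / (a - b) ^ 2 := by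
    rw [hfg, rootS]; field_simp; ring
  have h5 : ξ = (quart H e k a - f ^ 2) / (a - b) ^ 2 := by rw [hf]; field_simp; ring
  have h6 : η = (quart H e k b - g ^ 2) / (a - b) ^ 2 := by rw [hg]; field_simp; ring
  rw [h4, h5, h6]
  generalize quart H e k a = A at *
  generalize quart H e k b = B at *
  generalize rootSa H e k a b r = u at *
  field_simp
  linear_combination u * f * h2

/-- The bracket of the two roots, expanded along `z₁, z₂, H, K`, vanishes. -/
lemma roots_commute {w : ℂ} (hr : r ≠ 0) (h2 : r ^ 2 = quart H e k a * quart H e k b)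
    (hab : a - b ≠ 0) (hw : (a - b) * w = f + g) :
    (rootSa H e k a b r * rootSa H e k b a (-r) - rootSa H e k b a r * rootSa H e k a b (-r)) * w
      - (rootSa H e k a b r * f + rootSa H e k b a r * g)
        * (rootSH H e k a b (-r) + 2 * (2 * rootS H e k a b (-r) + H) * rootSk H e k a b (-r))
      + (rootSa H e k a b (-r) * f + rootSa H e k b a (-r) * g)
        * (rootSH H e k a b r + 2 * (2 * rootS H e k a b r + H) * rootSk H e k a b r) = 0 := by
  have hr' : -r ≠ 0 := neg_ne_zero.mpr hr
  have h2' : (-r) ^ 2 = quart H e k a * quart H e k b := by rw [neg_sq, h2]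
  have hw' : w = (f + g) / (a - b) := by rw [← hw]; field_simp
  rw [rootSH_add hr h2 hab, rootSH_add hr' h2' hab, rootSa_swap hr h2 hab,
    rootSa_swap hr' h2' hab, hw']
  generalize quart H e k a = A at *
  generalize quart H e k b = B at *
  generalize rootSa H e k a b r = u at *
  generalize rootSa H e k a b (-r) = v at *
  field_simp
  ring

end Flows

section Smooth

variable {𝕜 : Type*} [NontriviallyNormedField 𝕜] [NormedAlgebra 𝕜 ℂ]

@[fun_prop]
lemma contDiff_x (k : Fin 3) : ContDiff 𝕜 ∞ (x (𝕜 := 𝕜) k) := (dx (𝕜 := 𝕜) k).contDiff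

@[fun_prop]
lemma contDiff_J (k : Fin 3) : ContDiff 𝕜 ∞ (J (𝕜 := 𝕜) k) := (dJ (𝕜 := 𝕜) k).contDiff

@[fun_prop]
lemma contDiff_casA : ContDiff 𝕜 ∞ (casA (𝕜 := 𝕜)) := by
  unfold casA; fun_prop

@[fun_prop]
lemma contDiff_casB : ContDiff 𝕜 ∞ (casB (𝕜 := 𝕜)) := by
  unfold casB; fun_prop

@[fun_prop]
lemma contDiff_z₁ : ContDiff 𝕜 ∞ (z₁ (𝕜 := 𝕜)) := by
  unfold z₁; fun_prop

@[fun_prop]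
lemma contDiff_z₂ : ContDiff 𝕜 ∞ (z₂ (𝕜 := 𝕜)) := by
  unfold z₂; fun_prop

@[fun_prop]
lemma contDiff_Ham (c₁ c₂ : ℂ) : ContDiff 𝕜 ∞ (Ham (𝕜 := 𝕜) c₁ c₂) := by
  unfold Ham; fun_prop

@[fun_prop]
lemma contDiff_Kint (c₁ c₂ : ℂ) : ContDiff 𝕜 ∞ (Kint (𝕜 := 𝕜) c₁ c₂) := by
  unfold Kint
  simp only [xiHat_eq, xiHatStar_eq]
  fun_prop

lemma contDiff_F (c₁ c₂ : ℂ) {z : E3 𝕜 → ℂ} (hz : ContDiff 𝕜 ∞ z) :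
    ContDiff 𝕜 ∞ (fun m => F c₁ c₂ m (z m)) := by
  unfold F; fun_prop

lemma contDiff_F₂ (c₁ c₂ : ℂ) : ContDiff 𝕜 ∞ (F₂ (𝕜 := 𝕜) c₁ c₂) := by
  have h1 := contDiff_F c₁ c₂ (contDiff_z₁ (𝕜 := 𝕜))
  have h2 := contDiff_F c₁ c₂ (contDiff_z₂ (𝕜 := 𝕜))
  unfold F₂; fun_prop

lemma contDiffAt_bracket {f g : E3 𝕜 → ℂ} {m : E3 𝕜} (hf : ContDiffAt 𝕜 ∞ f m)
    (hg : ContDiffAt 𝕜 ∞ g m) : ContDiffAt 𝕜 ∞ (bracket f g) m := by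
  have e : bracket f g = fun n => poisson n (fderiv 𝕜 f n) (fderiv 𝕜 g n) := rfl
  have h1 : ∀ v, ContDiffAt 𝕜 ∞ (fun n => fderiv 𝕜 f n v) m := fun v =>
    (hf.fderiv_right (by simp)).clm_apply contDiffAt_const
  have h2 : ∀ v, ContDiffAt 𝕜 ∞ (fun n => fderiv 𝕜 g n v) m := fun v =>
    (hg.fderiv_right (by simp)).clm_apply contDiffAt_const
  rw [e]
  simp only [poisson_eq]
  fun_prop

end Smooth

/-! ### The separation variables -/

section Separation

variable {𝕜 : Type*} [NontriviallyNormedField 𝕜] [NormedAlgebra 𝕜 ℂ]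

lemma F_eq_quart (c₁ c₂ : ℂ) (m : E3 𝕜) (z : ℂ) :
    F c₁ c₂ m z = quart (Ham c₁ c₂ m) (4 * c₁ * casB m) (F c₁ c₂ m 0) z := by
  simp only [F, quart]; ring

lemma F₂_eq_quartPolar (c₁ c₂ : ℂ) (m : E3 𝕜) :
    F₂ c₁ c₂ m = quartPolar (Ham c₁ c₂ m) (4 * c₁ * casB m) (F c₁ c₂ m 0) (z₁ m) (z₂ m) := by
  simp only [F₂, F, quartPolar]; ring

lemma P₅_eq (c₁ c₂ : ℂ) (m : E3 𝕜) (s : ℂ) :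
    P₅ c₁ c₂ m s = resolvent (Ham c₁ c₂ m) (4 * c₁ * casB m) (F c₁ c₂ m 0) s
      * ((2 * s + (Ham c₁ c₂ m + c₂ ^ 2 * casA m)) ^ 2
        - xiHat c₁ c₂ m * xiHatStar c₁ c₂ m) := by
  simp only [P₅, P₃, P₂, F, resolvent, Kint]; ring

/-- The root `(F(z₁, z₂) + r) / (2 (z₁ - z₂)²)`; the variables `sepVar` are `kowVar (± R)`. -/
def kowVar (c₁ c₂ : ℂ) (r : E3 𝕜 → ℂ) (m : E3 𝕜) : ℂ :=
  (F₂ c₁ c₂ m + r m) / (2 * (z₁ m - z₂ m) ^ 2)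

lemma kowVar_eq_rootS (c₁ c₂ : ℂ) (r : E3 𝕜 → ℂ) (m : E3 𝕜) :
    kowVar c₁ c₂ r m = rootS (Ham c₁ c₂ m) (4 * c₁ * casB m) (F c₁ c₂ m 0) (z₁ m) (z₂ m) (r m) := by
  rw [kowVar, F₂_eq_quartPolar]; rfl

lemma sepVar_zero (c₁ c₂ : ℂ) (R : E3 𝕜 → ℂ) : sepVar c₁ c₂ R 0 = kowVar c₁ c₂ R := by
  funext m; simp [sepVar, kowVar]

lemma sepVar_one (c₁ c₂ : ℂ) (R : E3 𝕜 → ℂ) :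
    sepVar c₁ c₂ R 1 = kowVar c₁ c₂ (fun m => -R m) := by
  funext m; simp [sepVar, kowVar]

/-- Near `m`, `r` is a square root of `F(z₁) F(z₂)`; at `m` it is smooth and nonzero, and `z₁ ≠ z₂`. -/
structure IsRootAt (c₁ c₂ : ℂ) (r : E3 𝕜 → ℂ) (m : E3 𝕜) : Prop where
  smooth : ContDiffAt 𝕜 ∞ r m
  ne_zero : r m ≠ 0
  sq : ∀ᶠ n in nhds m, r n ^ 2 = F c₁ c₂ n (z₁ n) * F c₁ c₂ n (z₂ n)
  sub_ne : z₁ m - z₂ m ≠ 0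

/-- The covector `p dz₁ + q dz₂ + c dH + d dK + α dA + β dB` at `m`. -/
def kowForm (c₁ c₂ : ℂ) (m : E3 𝕜) (p q c d α β : ℂ) : E3 𝕜 →L[𝕜] ℂ :=
  p • fderiv 𝕜 z₁ m + q • fderiv 𝕜 z₂ m + c • fderiv 𝕜 (Ham c₁ c₂) m
    + d • fderiv 𝕜 (Kint c₁ c₂) m + α • fderiv 𝕜 casA m + β • fderiv 𝕜 casB m

lemma poisson_kowForm_right (c₁ c₂ : ℂ) (m : E3 𝕜) (γ : E3 𝕜 →L[𝕜] ℂ) (p q c d α β : ℂ) :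
    poisson m γ (kowForm c₁ c₂ m p q c d α β) =
      p * poisson m γ (fderiv 𝕜 z₁ m) + q * poisson m γ (fderiv 𝕜 z₂ m)
        + c * poisson m γ (fderiv 𝕜 (Ham c₁ c₂) m)
        + d * poisson m γ (fderiv 𝕜 (Kint c₁ c₂) m) := by
  simp only [kowForm, poisson_add_right, poisson_smul_right, poisson_casA, poisson_casB]
  ring

lemma poisson_kowForm_left (c₁ c₂ : ℂ) (m : E3 𝕜) (γ : E3 𝕜 →L[𝕜] ℂ) (p q c d α β : ℂ) :
    poisson m (kowForm c₁ c₂ m p q c d α β) γ =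
      p * poisson m (fderiv 𝕜 z₁ m) γ + q * poisson m (fderiv 𝕜 z₂ m) γ
        + c * poisson m (fderiv 𝕜 (Ham c₁ c₂) m) γ
        + d * poisson m (fderiv 𝕜 (Kint c₁ c₂) m) γ := by
  simp only [poisson_swap m _ γ, poisson_kowForm_right]
  ring

variable {c₁ c₂ : ℂ} {r : E3 𝕜 → ℂ} {m : E3 𝕜}

lemma IsRootAt.neg (h : IsRootAt c₁ c₂ r m) : IsRootAt c₁ c₂ (fun n => -r n) m where
  smooth := h.smooth.neg
  ne_zero := neg_ne_zero.mpr h.ne_zero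
  sq := by simpa only [neg_sq] using h.sq
  sub_ne := h.sub_ne

lemma IsRootAt.sq_eq_quart (h : IsRootAt c₁ c₂ r m) :
    r m ^ 2 = quart (Ham c₁ c₂ m) (4 * c₁ * casB m) (F c₁ c₂ m 0) (z₁ m)
      * quart (Ham c₁ c₂ m) (4 * c₁ * casB m) (F c₁ c₂ m 0) (z₂ m) := by
  rw [h.sq.self_of_nhds, F_eq_quart c₁ c₂ m (z₁ m), F_eq_quart c₁ c₂ m (z₂ m)]

lemma IsRootAt.contDiffAt_kowVar (h : IsRootAt c₁ c₂ r m) :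
    ContDiffAt 𝕜 ∞ (kowVar c₁ c₂ r) m := by
  have h1 := (contDiff_F₂ (𝕜 := 𝕜) c₁ c₂).contDiffAt (x := m)
  have h2 := (contDiff_z₁ (𝕜 := 𝕜)).contDiffAt (x := m)
  have h3 := (contDiff_z₂ (𝕜 := 𝕜)).contDiffAt (x := m)
  unfold kowVar
  simp only [div_eq_mul_inv]
  refine (h1.add h.smooth).mul (ContDiffAt.inv ?_ (by simpa using h.sub_ne))
  fun_prop

/-- The constant coefficient of `F` depends on the phase point through `Ĥ, K̂, A, B` only. -/
lemma hasFDerivAt_F_zero (c₁ c₂ : ℂ) (m : E3 𝕜) :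
    HasFDerivAt (fun n => F c₁ c₂ n 0) (kowForm c₁ c₂ m 0 0 (-2 * c₂ ^ 2 * casA m) 1
      (-4 * c₁ ^ 2 - 2 * c₂ ^ 2 * Ham c₁ c₂ m - 2 * c₂ ^ 4 * casA m)
      (8 * c₂ ^ 2 * casB m)) m := by
  have hH := (hasFDerivAt_Ham c₁ c₂ m).differentiableAt.hasFDerivAt
  have hA := (hasFDerivAt_casA m).differentiableAt.hasFDerivAt
  have hB := (hasFDerivAt_casB m).differentiableAt.hasFDerivAt
  have hK := (hasFDerivAt_Kint c₁ c₂ m).differentiableAt.hasFDerivAt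
  have h := ((hK.sub (hA.const_mul (4 * c₁ ^ 2))).add ((((hB.pow 2).const_mul 2).sub
    (hH.mul hA)).const_mul (2 * c₂ ^ 2))).sub ((hA.pow 2).const_mul (c₂ ^ 4))
  refine (h.congr_of_eventuallyEq (.of_forall fun n => ?_)).congr_fderiv ?_
  · simp [F]; ring
  · ext v
    · simp [kowForm]; ring
    · simp [kowForm]; ring

/-- The differential of a separation variable along `z₁, z₂, Ĥ, K̂`.  The coefficients of the Casimir
functions do not matter for brackets.  The arguments of the partial derivatives are variables here
in order to keep the statement short. -/
lemma IsRootAt.exists_hasFDerivAt (h : IsRootAt c₁ c₂ r m) {H e k a b ρ : ℂ}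
    (hH : H = Ham c₁ c₂ m) (he : e = 4 * c₁ * casB m) (hk : k = F c₁ c₂ m 0) (ha : a = z₁ m)
    (hb : b = z₂ m) (hρ : ρ = r m) :
    ∃ α β, HasFDerivAt (kowVar c₁ c₂ r) (kowForm c₁ c₂ m (rootSa H e k a b ρ) (rootSa H e k b a ρ)
      (rootSH H e k a b ρ - 2 * c₂ ^ 2 * casA m * rootSk H e k a b ρ) (rootSk H e k a b ρ) α β)
      m := by
  have hB := (hasFDerivAt_casB m).differentiableAt.hasFDerivAt
  have h1 := hasFDerivAt_rootS (hasFDerivAt_Ham c₁ c₂ m).differentiableAt.hasFDerivAt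
    (hB.const_mul (4 * c₁)) (hasFDerivAt_F_zero c₁ c₂ m)
    (hasFDerivAt_z₁ m).differentiableAt.hasFDerivAt (hasFDerivAt_z₂ m).differentiableAt.hasFDerivAt
    (h.smooth.differentiableAt (by simp))
    (h.sq.mono fun n hn => by rw [hn, F_eq_quart c₁ c₂ n (z₁ n), F_eq_quart c₁ c₂ n (z₂ n)])
    h.ne_zero h.sub_ne
  refine ⟨rootSk H e k a b ρ
      * (-4 * c₁ ^ 2 - 2 * c₂ ^ 2 * Ham c₁ c₂ m - 2 * c₂ ^ 4 * casA m),
    rootSk H e k a b ρ * (8 * c₂ ^ 2 * casB m) + rootSe H e k a b ρ * (4 * c₁), ?_⟩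
  subst hH he hk ha hb hρ
  refine (h1.congr_of_eventuallyEq
    (.of_forall fun n => kowVar_eq_rootS c₁ c₂ r n)).congr_fderiv ?_
  simp only [kowForm]
  module

lemma IsRootAt.bracket_Ham_kowVar (h : IsRootAt c₁ c₂ r m) {H e k a b ρ : ℂ}
    (hH : H = Ham c₁ c₂ m) (he : e = 4 * c₁ * casB m) (hk : k = F c₁ c₂ m 0) (ha : a = z₁ m)
    (hb : b = z₂ m) (hρ : ρ = r m) :
    bracket (Ham c₁ c₂) (kowVar c₁ c₂ r) m =
      rootSa H e k a b ρ * bracket (Ham c₁ c₂) z₁ m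
        + rootSa H e k b a ρ * bracket (Ham c₁ c₂) z₂ m := by
  obtain ⟨α, β, h1⟩ := h.exists_hasFDerivAt hH he hk ha hb hρ
  rw [bracket_eq_poisson (hasFDerivAt_Ham c₁ c₂ m).differentiableAt.hasFDerivAt h1,
    poisson_kowForm_right, poisson_self]
  simp [poisson_fderiv, bracket_Ham_Kint]

lemma IsRootAt.bracket_Kint_kowVar_expand (h : IsRootAt c₁ c₂ r m) {H e k a b ρ : ℂ}
    (hH : H = Ham c₁ c₂ m) (he : e = 4 * c₁ * casB m) (hk : k = F c₁ c₂ m 0) (ha : a = z₁ m)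
    (hb : b = z₂ m) (hρ : ρ = r m) :
    bracket (Kint c₁ c₂) (kowVar c₁ c₂ r) m =
      rootSa H e k a b ρ * bracket (Kint c₁ c₂) z₁ m
        + rootSa H e k b a ρ * bracket (Kint c₁ c₂) z₂ m := by
  obtain ⟨α, β, h1⟩ := h.exists_hasFDerivAt hH he hk ha hb hρ
  rw [bracket_eq_poisson (hasFDerivAt_Kint c₁ c₂ m).differentiableAt.hasFDerivAt h1,
    poisson_kowForm_right, poisson_self]
  simp [poisson_fderiv, bracket_swap (Kint c₁ c₂) (Ham c₁ c₂), bracket_Ham_Kint]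

lemma IsRootAt.kowVar_sub (h : IsRootAt c₁ c₂ r m) :
    kowVar c₁ c₂ r m - kowVar c₁ c₂ (fun n => -r n) m = r m / (z₁ m - z₂ m) ^ 2 := by
  rw [kowVar_eq_rootS, kowVar_eq_rootS, rootS_sub_rootS_neg h.sub_ne]

lemma IsRootAt.kowVar_sub_ne_zero (h : IsRootAt c₁ c₂ r m) :
    kowVar c₁ c₂ r m - kowVar c₁ c₂ (fun n => -r n) m ≠ 0 := by
  rw [h.kowVar_sub]
  exact div_ne_zero h.ne_zero (pow_ne_zero 2 h.sub_ne)

lemma quart_Ham_z₁ (c₁ c₂ : ℂ) (m : E3 𝕜) :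
    bracket (Ham c₁ c₂) z₁ m ^ 2 = quart (Ham c₁ c₂ m) (4 * c₁ * casB m) (F c₁ c₂ m 0) (z₁ m)
      - xiHat c₁ c₂ m * (z₁ m - z₂ m) ^ 2 := by
  rw [bracket_Ham_z₁_sq, F_eq_quart]

lemma quart_Ham_z₂ (c₁ c₂ : ℂ) (m : E3 𝕜) :
    bracket (Ham c₁ c₂) z₂ m ^ 2 = quart (Ham c₁ c₂ m) (4 * c₁ * casB m) (F c₁ c₂ m 0) (z₂ m)
      - xiHatStar c₁ c₂ m * (z₁ m - z₂ m) ^ 2 := by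
  rw [bracket_Ham_z₂_sq, F_eq_quart]

/-- The square of `(s₁ - s₂) ṡ₁` is `P₅(s₁)`. -/
lemma IsRootAt.velocity_sq (h : IsRootAt c₁ c₂ r m) :
    ((kowVar c₁ c₂ r m - kowVar c₁ c₂ (fun n => -r n) m)
      * bracket (Ham c₁ c₂) (kowVar c₁ c₂ r) m) ^ 2 = P₅ c₁ c₂ m (kowVar c₁ c₂ r m) := by
  rw [h.kowVar_sub, h.bracket_Ham_kowVar rfl rfl rfl rfl rfl rfl,
    DeformedKowalevski.velocity_sq h.ne_zero h.sq_eq_quart h.sub_ne (quart_Ham_z₁ c₁ c₂ m)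
      (quart_Ham_z₂ c₁ c₂ m)
      (by rw [← F₂_eq_quartPolar]; exact bracket_Ham_z₁_mul_bracket_Ham_z₂ c₁ c₂ m),
    P₅_eq, kowVar_eq_rootS]

/-- The Hamiltonian flows of `Ĥ` and `K̂` move each separation variable at rates whose ratio depends
on the other variable and the integrals only. -/
lemma IsRootAt.bracket_Kint_kowVar (h : IsRootAt c₁ c₂ r m) :
    bracket (Kint c₁ c₂) (kowVar c₁ c₂ r) m =
      2 * (2 * kowVar c₁ c₂ (fun n => -r n) m + (Ham c₁ c₂ m + c₂ ^ 2 * casA m))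
        * bracket (Ham c₁ c₂) (kowVar c₁ c₂ r) m := by
  rw [h.bracket_Kint_kowVar_expand rfl rfl rfl rfl rfl rfl,
    h.bracket_Ham_kowVar rfl rfl rfl rfl rfl rfl, bracket_Kint_z₁, bracket_Kint_z₂,
    second_velocity h.ne_zero h.sq_eq_quart h.sub_ne (quart_Ham_z₁ c₁ c₂ m)
      (quart_Ham_z₂ c₁ c₂ m)
      (by rw [← F₂_eq_quartPolar]; exact bracket_Ham_z₁_mul_bracket_Ham_z₂ c₁ c₂ m),
    kowVar_eq_rootS]

/-- The separation variables Poisson-commute. -/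
lemma IsRootAt.bracket_kowVar (h : IsRootAt c₁ c₂ r m) :
    bracket (kowVar c₁ c₂ r) (kowVar c₁ c₂ (fun n => -r n)) m = 0 := by
  have e1 := h.bracket_Ham_kowVar rfl rfl rfl rfl rfl rfl
  have e2 := h.neg.bracket_Ham_kowVar rfl rfl rfl rfl rfl rfl
  have e3 := h.bracket_Kint_kowVar
  have e4 := h.neg.bracket_Kint_kowVar
  have e5 := h.bracket_Kint_kowVar_expand rfl rfl rfl rfl rfl rfl
  have e6 := h.neg.bracket_Kint_kowVar_expand rfl rfl rfl rfl rfl rfl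
  obtain ⟨α, β, h1⟩ := h.exists_hasFDerivAt rfl rfl rfl rfl rfl rfl
  obtain ⟨α', β', h2⟩ := h.neg.exists_hasFDerivAt rfl rfl rfl rfl rfl rfl
  have key := roots_commute h.ne_zero h.sq_eq_quart h.sub_ne (bracket_z₁_z₂ c₁ c₂ m)
  rw [← e1, ← e2, ← kowVar_eq_rootS c₁ c₂ r m, ← kowVar_eq_rootS c₁ c₂ (fun n => -r n) m] at key
  simp only [neg_neg] at e4
  rw [e3] at e5
  rw [e4] at e6
  rw [bracket_eq_poisson h1 h2]
  simp only [poisson_kowForm_left, poisson_kowForm_right, poisson_self, poisson_fderiv,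
    bracket_swap z₂ z₁, bracket_swap z₁ (Ham c₁ c₂), bracket_swap z₂ (Ham c₁ c₂),
    bracket_swap z₁ (Kint c₁ c₂), bracket_swap z₂ (Kint c₁ c₂),
    bracket_swap (Kint c₁ c₂) (Ham c₁ c₂), bracket_Ham_Kint]
  generalize rootSk (Ham c₁ c₂ m) (4 * c₁ * casB m) (F c₁ c₂ m 0) (z₁ m) (z₂ m) (r m) = k₁ at *
  generalize rootSk (Ham c₁ c₂ m) (4 * c₁ * casB m) (F c₁ c₂ m 0) (z₁ m) (z₂ m) (-r m) = k₂ at *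
  generalize rootSH (Ham c₁ c₂ m) (4 * c₁ * casB m) (F c₁ c₂ m 0) (z₁ m) (z₂ m) (r m) = η₁ at *
  generalize rootSH (Ham c₁ c₂ m) (4 * c₁ * casB m) (F c₁ c₂ m 0) (z₁ m) (z₂ m) (-r m) = η₂ at *
  linear_combination key + k₂ * e5 - k₁ * e6 + (η₂ - 2 * c₂ ^ 2 * casA m * k₂) * e1
    - (η₁ - 2 * c₂ ^ 2 * casA m * k₁) * e2

end Separation

/-! ### Canonical covectors and conjugate momenta -/

section Leaves

variable {𝕜 : Type*} [NontriviallyNormedField 𝕜] [NormedAlgebra 𝕜 ℂ]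

/-- Where `x = 0` the Poisson tensor has rank at most two, so that its values on four covectors
satisfy a Plücker relation. -/
lemma poisson_pluecker {m : E3 𝕜} (hx : ∀ k, x k m = 0) (α β γ δ : E3 𝕜 →L[𝕜] ℂ) :
    poisson m α β * poisson m γ δ - poisson m α γ * poisson m β δ
      + poisson m α δ * poisson m β γ = 0 := by
  simp only [poisson_eq, hx]
  ring

lemma apply_eq_sum (γ : E3 𝕜 →L[𝕜] ℂ) (v : E3 𝕜) :
    γ v = (∑ k, γ (Pi.single k 1, 0) * algebraMap 𝕜 ℂ (v.1 k))
      + ∑ k, γ (0, Pi.single k 1) * algebraMap 𝕜 ℂ (v.2 k) := by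
  have e : v = (∑ k, v.1 k • (Pi.single k 1, 0)) + ∑ k, v.2 k • (0, Pi.single k 1) := by
    ext k <;> fin_cases k <;> simp [Fin.sum_univ_three]
  conv_lhs => rw [e]
  simp only [map_add, map_sum, map_smul]
  simp only [Algebra.smul_def, mul_comm]

/-- A canonical system of covectors, together with the differentials of the Casimir functions,
separates tangent vectors. -/
lemma eq_zero_of_canonical {m : E3 𝕜} {s₀ s₁ p₀ p₁ : E3 𝕜 →L[𝕜] ℂ}
    (h00 : poisson m s₀ p₀ = 1) (h11 : poisson m s₁ p₁ = 1) (h01 : poisson m s₀ p₁ = 0)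
    (h10 : poisson m s₁ p₀ = 0) (hs : poisson m s₀ s₁ = 0) (hp : poisson m p₀ p₁ = 0)
    {v : E3 𝕜} (hA : fderiv 𝕜 casA m v = 0) (hB : fderiv 𝕜 casB m v = 0) (hs0 : s₀ v = 0)
    (hs1 : s₁ v = 0) (hp0 : p₀ v = 0) (hp1 : p₁ v = 0) : v = 0 := by
  -- at points with `x = 0` the rank of the Poisson tensor is too small for a canonical system
  have hx : ∃ k, x k m ≠ 0 := by
    by_contra! hx
    have := poisson_pluecker hx s₀ p₀ s₁ p₁
    rw [h00, h11, hs, h01, poisson_swap m p₀ s₁, h10, hp] at this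
    simp at this
  let γ : Fin 3 ⊕ Fin 3 → (E3 𝕜 →L[𝕜] ℂ) :=
    Sum.elim ![fderiv 𝕜 casA m, s₀, s₁] ![fderiv 𝕜 casB m, p₀, p₁]
  let e : Fin 3 ⊕ Fin 3 → E3 𝕜 :=
    Sum.elim (fun k => (Pi.single k 1, 0)) (fun k => (0, Pi.single k 1))
  let M : Matrix (Fin 3 ⊕ Fin 3) (Fin 3 ⊕ Fin 3) ℂ := Matrix.of fun i k => γ i (e k)
  let w : Fin 3 ⊕ Fin 3 → ℂ :=
    Sum.elim (fun k => algebraMap 𝕜 ℂ (v.1 k)) (fun k => algebraMap 𝕜 ℂ (v.2 k))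
  have hw : M.mulVec w = 0 := by
    funext i
    have h1 : M.mulVec w i = γ i v := by
      simp [Matrix.mulVec, dotProduct, M, w, e, apply_eq_sum (γ i) v]
    rw [h1]
    rcases i with i | i <;> fin_cases i <;> simp [γ, *]
  have hM : M.det ≠ 0 := by
    intro h0
    -- pairing a linear relation between the six covectors with `s₀, s₁, p₀, p₁` leaves a relation
    -- between `dA` and `dB`, which are independent where `x ≠ 0`
    obtain ⟨c, hc0, hc⟩ := Matrix.exists_vecMul_eq_zero_iff.mpr h0
    refine hc0 ?_
    have hδ : ∀ β, poisson m (∑ i, c i • γ i) β = 0 := by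
      intro β
      have h2 : ∀ k, (∑ i, c i • γ i) (e k) = 0 := fun k => by
        have := congrFun hc k
        simpa [Matrix.vecMul, dotProduct, M] using this
      have h3 := fun k => h2 (Sum.inl k)
      have h4 := fun k => h2 (Sum.inr k)
      simp only [e, Sum.elim_inl, Sum.elim_inr] at h3 h4
      simp only [poisson_eq, h3, h4]
      ring
    simp only [γ, Fintype.sum_sum_type, Fin.sum_univ_three, Sum.elim_inl, Sum.elim_inr,
      Matrix.cons_val_zero, Matrix.cons_val_one, Matrix.cons_val, poisson_add_left,
      poisson_smul_left, poisson_swap m (fderiv 𝕜 casA m), poisson_swap m (fderiv 𝕜 casB m),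
      poisson_casA, poisson_casB] at hδ
    have k1 := hδ s₀
    have k2 := hδ s₁
    have k3 := hδ p₀
    have k4 := hδ p₁
    simp [poisson_self, poisson_swap m p₀ s₀, poisson_swap m p₀ s₁, poisson_swap m p₁ s₀,
      poisson_swap m p₁ s₁, poisson_swap m s₁ s₀, poisson_swap m p₁ p₀, *] at k1 k2 k3 k4
    have hA' := (hasFDerivAt_casA m).fderiv
    have hB' := (hasFDerivAt_casB m).fderiv
    have h5 : ∀ k, c (Sum.inl 0) * (2 * x k m) + c (Sum.inr 0) * J k m = 0 := fun k => by
      have := congrFun hc (Sum.inl k)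
      fin_cases k <;>
      simpa [Matrix.vecMul, dotProduct, M, γ, e, Fin.sum_univ_three, k1, k2, k3, k4, hA', hB',
        covec_apply_x] using this
    have h6 : ∀ k, c (Sum.inr 0) * x k m = 0 := fun k => by
      have := congrFun hc (Sum.inr k)
      fin_cases k <;>
      simpa [Matrix.vecMul, dotProduct, M, γ, e, Fin.sum_univ_three, k1, k2, k3, k4, hA', hB',
        covec_apply_J] using this
    obtain ⟨k, hk⟩ := hx
    have h7 : c (Sum.inr 0) = 0 := by simpa [hk] using h6 k
    have h8 : c (Sum.inl 0) = 0 := by simpa [hk, h7] using h5 k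
    funext i
    rcases i with i | i <;> fin_cases i <;> simp [*]
  have hw0 := Matrix.eq_zero_of_mulVec_eq_zero hM hw
  ext k
  · simpa [w] using congrFun hw0 (Sum.inl k)
  · simpa [w] using congrFun hw0 (Sum.inr k)

end Leaves

section Momenta

variable {𝕜 : Type*} [NontriviallyNormedField 𝕜] [NormedAlgebra 𝕜 ℂ] {c₁ c₂ : ℂ}
  {r p : E3 𝕜 → ℂ} {m : E3 𝕜}

/-- `p` has the differential of the momentum conjugate to `kowVar c₁ c₂ r`, up to the differentials
of the Casimir functions and of the variable itself. -/
def IsMomentumAt (c₁ c₂ : ℂ) (r p : E3 𝕜 → ℂ) (m : E3 𝕜) : Prop :=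
  ∃ q u α β : ℂ, q ≠ 0 ∧ q = (kowVar c₁ c₂ r m - kowVar c₁ c₂ (fun n => -r n) m)
      * bracket (Ham c₁ c₂) (kowVar c₁ c₂ r) m ∧
    HasFDerivAt p (u • fderiv 𝕜 (kowVar c₁ c₂ r) m
      + (-(2 * kowVar c₁ c₂ r m + Ham c₁ c₂ m + c₂ ^ 2 * casA m) / (2 * q))
        • fderiv 𝕜 (Ham c₁ c₂) m
      + (1 / (4 * q)) • fderiv 𝕜 (Kint c₁ c₂) m
      + α • fderiv 𝕜 casA m + β • fderiv 𝕜 casB m) m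

/-- Contracting the covector of the momentum with the rates `{Ĥ, s}` and `{K̂, s}` leaves the
difference of the two variables, which cancels against `q`. -/
lemma IsMomentumAt.bracket_kowVar_self (hp : IsMomentumAt c₁ c₂ r p m)
    (h : IsRootAt c₁ c₂ r m) : bracket (kowVar c₁ c₂ r) p m = 1 := by
  obtain ⟨q, u, α, β, hq, hqe, hd⟩ := hp
  rw [bracket_eq_poisson (h.contDiffAt_kowVar.differentiableAt (by simp)).hasFDerivAt hd]
  simp only [poisson_add_right, poisson_smul_right, poisson_casA, poisson_casB, poisson_self,
    poisson_fderiv, bracket_swap (kowVar c₁ c₂ r) (Ham c₁ c₂),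
    bracket_swap (kowVar c₁ c₂ r) (Kint c₁ c₂), h.bracket_Kint_kowVar]
  field_simp
  rw [hqe]
  ring

lemma IsMomentumAt.bracket_kowVar_neg (hp : IsMomentumAt c₁ c₂ r p m)
    (h : IsRootAt c₁ c₂ r m) : bracket (kowVar c₁ c₂ (fun n => -r n)) p m = 0 := by
  obtain ⟨q, u, α, β, hq, -, hd⟩ := hp
  have hK := h.neg.bracket_Kint_kowVar
  simp only [neg_neg] at hK
  rw [bracket_eq_poisson (h.neg.contDiffAt_kowVar.differentiableAt (by simp)).hasFDerivAt hd]
  simp only [poisson_add_right, poisson_smul_right, poisson_casA, poisson_casB, poisson_fderiv,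
    bracket_swap _ (Ham c₁ c₂), bracket_swap _ (Kint c₁ c₂), hK,
    bracket_swap (kowVar c₁ c₂ (fun n => -r n)) (kowVar c₁ c₂ r), h.bracket_kowVar]
  field_simp
  ring

lemma IsMomentumAt.bracket_momentum {p' : E3 𝕜 → ℂ} (hp : IsMomentumAt c₁ c₂ r p m)
    (hp' : IsMomentumAt c₁ c₂ (fun n => -r n) p' m) (h : IsRootAt c₁ c₂ r m) :
    bracket p p' m = 0 := by
  have h0 := hp.bracket_kowVar_neg h
  obtain ⟨q, u, α, β, hq, -, hd⟩ := hp
  obtain ⟨q', u', α', β', hq', -, hd'⟩ := hp'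
  have e1 : bracket p (Ham c₁ c₂) m = -u * bracket (Ham c₁ c₂) (kowVar c₁ c₂ r) m := by
    rw [bracket_swap, bracket_eq_poisson (hasFDerivAt_Ham c₁ c₂ m).differentiableAt.hasFDerivAt hd]
    simp only [poisson_add_right, poisson_smul_right, poisson_casA, poisson_casB, poisson_self,
      poisson_fderiv, bracket_Ham_Kint]
    ring
  have e2 : bracket p (Kint c₁ c₂) m = -u * bracket (Kint c₁ c₂) (kowVar c₁ c₂ r) m := by
    rw [bracket_swap, bracket_eq_poisson (hasFDerivAt_Kint c₁ c₂ m).differentiableAt.hasFDerivAt hd]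
    simp only [poisson_add_right, poisson_smul_right, poisson_casA, poisson_casB, poisson_self,
      poisson_fderiv, bracket_swap (Kint c₁ c₂) (Ham c₁ c₂), bracket_Ham_Kint]
    ring
  rw [bracket_eq_poisson hd.differentiableAt.hasFDerivAt hd']
  simp only [poisson_add_right, poisson_smul_right, poisson_casA, poisson_casB,
    poisson_fderiv, e1, e2, bracket_swap p (kowVar c₁ c₂ (fun n => -r n)), h0,
    h.bracket_Kint_kowVar]
  field_simp
  ring

end Momenta

/-! ### Branches of the square root and the logarithm -/

section Branches

variable {𝕜 : Type*} [NontriviallyNormedField 𝕜] [NormedAlgebra 𝕜 ℂ] {c₁ c₂ : ℂ}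
  {r : E3 𝕜 → ℂ} {m : E3 𝕜}

/-- The argument of the logarithm and its inverse are the roots of `N X² + 2 S X + N = 0` with
`N = P₃ - s P₂` and `S = P₃ + s P₂`. -/
lemma cosh_sinh_mul_momDen {s w l : ℂ} (hN : momDen c₁ c₂ m s ≠ 0)
    (hw : w ^ 2 = s * P₅ c₁ c₂ m s) (he : Complex.exp l = momArg c₁ c₂ m s w) :
    Complex.cosh l * momDen c₁ c₂ m s = -(P₃ c₁ c₂ m s + s * P₂ c₁ c₂ m s) ∧
      Complex.sinh l * momDen c₁ c₂ m s = 2 * w := by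
  have hNS : momDen c₁ c₂ m s = P₃ c₁ c₂ m s - s * P₂ c₁ c₂ m s := by
    simp only [momDen, P₃, P₂]; ring
  rw [P₅] at hw
  have h1 : Complex.exp l * momDen c₁ c₂ m s = 2 * w - P₃ c₁ c₂ m s - s * P₂ c₁ c₂ m s := by
    rw [he, momArg]; field_simp
  have h2 : Complex.exp (-l) * momDen c₁ c₂ m s
      = -2 * w - P₃ c₁ c₂ m s - s * P₂ c₁ c₂ m s := by
    have h3 : Complex.exp l * Complex.exp (-l) = 1 := by rw [← Complex.exp_add]; simp
    have h4 : Complex.exp l * momDen c₁ c₂ m s ≠ 0 := mul_ne_zero (Complex.exp_ne_zero l) hN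
    refine mul_left_cancel₀ h4 ?_
    linear_combination momDen c₁ c₂ m s ^ 2 * h3
      + (2 * w + P₃ c₁ c₂ m s + s * P₂ c₁ c₂ m s) * h1
      + (momDen c₁ c₂ m s + P₃ c₁ c₂ m s - s * P₂ c₁ c₂ m s) * hNS + 4 * hw
  rw [Complex.cosh, Complex.sinh]
  constructor
  · linear_combination (h1 + h2) / 2
  · linear_combination (h1 - h2) / 2

lemma momNum_eq (c₁ c₂ : ℂ) (m : E3 𝕜) (s : ℂ) :
    momNum c₁ c₂ s (Ham c₁ c₂ m) (Kint c₁ c₂ m) (casA m) (casB m)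
      = P₃ c₁ c₂ m s + s * P₂ c₁ c₂ m s := by
  simp only [momNum, P₃, P₂]; ring

lemma contDiffAt_of_sq {g : E3 𝕜 → ℂ} (hg : ContinuousAt g m) (h0 : g m ≠ 0)
    (h : ContDiffAt 𝕜 ∞ (fun n => g n ^ 2) m) : ContDiffAt 𝕜 ∞ g m :=
  contDiffAt_of_comp (φ := fun z => z ^ 2) hg (by fun_prop) (hasDerivAt_pow 2 (g m))
    (by simpa using h0) h

/-- The momentum is smooth, since `√s` and the logarithm are branches of inverses of analytic
functions, and it has the differential that makes it conjugate to `s`. -/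
lemma IsRootAt.momentum (h : IsRootAt c₁ c₂ r m) {ρ ℓ q : E3 𝕜 → ℂ} (hρ : ContinuousAt ρ m)
    (hℓ : ContinuousAt ℓ m) (hq : ContDiffAt 𝕜 ∞ q m)
    (hqm : q m = (kowVar c₁ c₂ r m - kowVar c₁ c₂ (fun n => -r n) m)
      * bracket (Ham c₁ c₂) (kowVar c₁ c₂ r) m)
    (hs : kowVar c₁ c₂ r m ≠ 0) (hP : P₅ c₁ c₂ m (kowVar c₁ c₂ r m) ≠ 0)
    (hev : ∀ᶠ n in nhds m, momDen c₁ c₂ n (kowVar c₁ c₂ r n) ≠ 0 ∧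
      ρ n ^ 2 = kowVar c₁ c₂ r n ∧ q n ^ 2 = P₅ c₁ c₂ n (kowVar c₁ c₂ r n) ∧
      Complex.exp (ℓ n) = momArg c₁ c₂ n (kowVar c₁ c₂ r n) (ρ n * q n)) :
    ContDiffAt 𝕜 ∞ (momentum ρ ℓ) m ∧ IsMomentumAt c₁ c₂ r (momentum ρ ℓ) m := by
  obtain ⟨hN, hρ2, hq2, hexp⟩ := hev.self_of_nhds
  have hρ0 : ρ m ≠ 0 := fun h0 => hs (by rw [← hρ2, h0]; simp)
  have hq0 : q m ≠ 0 := fun h0 => hP (by rw [← hq2, h0]; simp)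
  have hsd := h.contDiffAt_kowVar
  have hρd : ContDiffAt 𝕜 ∞ ρ m :=
    contDiffAt_of_sq hρ hρ0 (hsd.congr_of_eventuallyEq (hev.mono fun n hn => hn.2.1))
  have hℓd : ContDiffAt 𝕜 ∞ ℓ m := by
    refine contDiffAt_of_comp hℓ Complex.contDiff_exp.contDiffAt (Complex.hasDerivAt_exp (ℓ m))
      (Complex.exp_ne_zero _) ?_
    refine ContDiffAt.congr_of_eventuallyEq ?_ (hev.mono fun n hn => hn.2.2.2)
    simp only [momArg, div_eq_mul_inv]
    refine ContDiffAt.mul ?_ (ContDiffAt.inv ?_ hN)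
    · simp only [P₃, P₂]
      fun_prop
    · simp only [momDen]
      fun_prop
  have hcs : ∀ᶠ n in nhds m,
      Complex.cosh (ℓ n) * momDen c₁ c₂ n (kowVar c₁ c₂ r n)
        = -(P₃ c₁ c₂ n (kowVar c₁ c₂ r n) + kowVar c₁ c₂ r n * P₂ c₁ c₂ n (kowVar c₁ c₂ r n)) ∧
      Complex.sinh (ℓ n) * momDen c₁ c₂ n (kowVar c₁ c₂ r n) = 2 * (ρ n * q n) := by
    filter_upwards [hev] with n ⟨h1, h2, h3, h4⟩
    exact cosh_sinh_mul_momDen h1 (by rw [mul_pow, h2, h3]) h4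
  constructor
  · have e : DeformedKowalevski.momentum ρ ℓ = fun n => (4 * ρ n)⁻¹ * ℓ n := by
      funext n; simp [DeformedKowalevski.momentum]
    rw [e]
    exact ContDiffAt.mul (ContDiffAt.inv (by fun_prop) (by simpa using hρ0)) hℓd
  · obtain ⟨u, α, β, hd⟩ := exists_hasFDerivAt_momentum c₁ c₂ (q := q m)
      (hsd.differentiableAt (by simp)).hasFDerivAt
      (hasFDerivAt_Ham c₁ c₂ m).differentiableAt.hasFDerivAt
      (hasFDerivAt_Kint c₁ c₂ m).differentiableAt.hasFDerivAt
      (hasFDerivAt_casA m).differentiableAt.hasFDerivAt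
      (hasFDerivAt_casB m).differentiableAt.hasFDerivAt
      (hρd.differentiableAt (by simp)) (hℓd.differentiableAt (by simp))
      (hev.mono fun n hn => hn.2.1)
      (hcs.mono fun n hn => by rw [momNum_eq]; exact hn.1) hcs.self_of_nhds.2 hρ0 hq0
    exact ⟨q m, u, α, β, hq0, hqm, hd⟩

/-- The two variables `sepVar` play symmetric roles: each is a `kowVar`, the other one belonging to
the opposite root. -/
lemma exists_sepVar_eq (c₁ c₂ : ℂ) (R : E3 𝕜 → ℂ) (i : Fin 2) :
    ∃ r : E3 𝕜 → ℂ, sepVar c₁ c₂ R i = kowVar c₁ c₂ r ∧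
      sepVar c₁ c₂ R (1 - i) = kowVar c₁ c₂ (fun n => -r n) ∧
      ∀ m, IsRootAt c₁ c₂ R m → IsRootAt c₁ c₂ r m := by
  fin_cases i
  · exact ⟨R, sepVar_zero c₁ c₂ R, sepVar_one c₁ c₂ R, fun _ h => h⟩
  · refine ⟨fun n => -R n, sepVar_one c₁ c₂ R, ?_, fun _ h => h.neg⟩
    simpa using sepVar_zero c₁ c₂ R

end Branches

end

end DeformedKowalevski

open DeformedKowalevski

theorem mainTheorem5 {𝕜 : Type*} [NontriviallyNormedField 𝕜] [NormedAlgebra 𝕜 ℂ] (c₁ c₂ : ℂ) :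
    -- on the whole phase space: the coefficients of `F` are integrals of motion,
    -- and the equations for `z₁, z₂` hold (`ḟ = {Ĥ, f}`)
    (∀ m : E3 𝕜,
      bracket (Ham c₁ c₂) casA m = 0 ∧ bracket (Ham c₁ c₂) casB m = 0 ∧
      bracket (Ham c₁ c₂) (Kint c₁ c₂) m = 0 ∧
      bracket (Ham c₁ c₂) z₁ m ^ 2 - F c₁ c₂ m (z₁ m)
        + xiHat c₁ c₂ m * (z₁ m - z₂ m) ^ 2 = 0 ∧
      bracket (Ham c₁ c₂) z₂ m ^ 2 - F c₁ c₂ m (z₂ m)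
        + xiHatStar c₁ c₂ m * (z₁ m - z₂ m) ^ 2 = 0) ∧
    -- on any open set with a branch `R` of `√(F(z₁) F(z₂))`
    (∀ (U : Set (E3 𝕜)) (R : E3 𝕜 → ℂ), IsOpen U → ContinuousOn R U →
      (∀ m ∈ U, z₁ m ≠ z₂ m ∧ R m ≠ 0 ∧
        R m ^ 2 = F c₁ c₂ m (z₁ m) * F c₁ c₂ m (z₂ m)) →
      -- the variables `s₁, s₂` are smooth, distinct, and Poisson-commute
      (∀ i, ContDiffOn 𝕜 ∞ (sepVar c₁ c₂ R i) U) ∧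
      (∀ m ∈ U, sepVar c₁ c₂ R 0 m ≠ sepVar c₁ c₂ R 1 m) ∧
      (∀ m ∈ U, bracket (sepVar c₁ c₂ R 0) (sepVar c₁ c₂ R 1) m = 0) ∧
      -- with suitable square roots `q i` of `P₅(s_i)`
      ∃ q : Fin 2 → E3 𝕜 → ℂ,
        (∀ i, ∀ m ∈ U, q i m ^ 2 = P₅ c₁ c₂ m (sepVar c₁ c₂ R i m)) ∧
        -- the hyperelliptic equations hold
        (∀ m ∈ U,
          bracket (Ham c₁ c₂) (sepVar c₁ c₂ R 0) m
            = q 0 m / (sepVar c₁ c₂ R 0 m - sepVar c₁ c₂ R 1 m) ∧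
          bracket (Ham c₁ c₂) (sepVar c₁ c₂ R 1) m
            = q 1 m / (sepVar c₁ c₂ R 1 m - sepVar c₁ c₂ R 0 m)) ∧
        -- and, for all branches `ρ i` of `√s_i` and `ℓ i` of the logarithm,
        ∀ ρ ℓ : Fin 2 → E3 𝕜 → ℂ,
          (∀ i, ContinuousOn (ρ i) U ∧ ContinuousOn (ℓ i) U) →
          (∀ i, ∀ m ∈ U,
            sepVar c₁ c₂ R i m ≠ 0 ∧
            P₅ c₁ c₂ m (sepVar c₁ c₂ R i m) ≠ 0 ∧
            momDen c₁ c₂ m (sepVar c₁ c₂ R i m) ≠ 0 ∧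
            ρ i m ^ 2 = sepVar c₁ c₂ R i m ∧
            Complex.exp (ℓ i m) = momArg c₁ c₂ m (sepVar c₁ c₂ R i m) (ρ i m * q i m)) →
          -- `s_i, p_i` are canonical
          (∀ i, ContDiffOn 𝕜 ∞ (momentum (ρ i) (ℓ i)) U) ∧
          (∀ i j, ∀ m ∈ U,
            bracket (sepVar c₁ c₂ R i) (momentum (ρ j) (ℓ j)) m = if i = j then 1 else 0) ∧
          (∀ m ∈ U, bracket (momentum (ρ 0) (ℓ 0)) (momentum (ρ 1) (ℓ 1)) m = 0) ∧
          -- `s_i, p_i` are coordinates on the common level sets of `A` and `B`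
          (∀ m ∈ U, ∀ v : E3 𝕜, fderiv 𝕜 casA m v = 0 → fderiv 𝕜 casB m v = 0 →
            (∀ i, fderiv 𝕜 (sepVar c₁ c₂ R i) m v = 0 ∧
              fderiv 𝕜 (momentum (ρ i) (ℓ i)) m v = 0) → v = 0) ∧
          -- the Hamilton function in these coordinates
          (∀ m ∈ U,
            Ham c₁ c₂ m
              = -sepVar c₁ c₂ R 0 m - sepVar c₁ c₂ R 1 m
                + c₁ ^ 2 * casB m ^ 2 / (2 * sepVar c₁ c₂ R 0 m * sepVar c₁ c₂ R 1 m)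
                - casA m * c₂ ^ 2 / 2
                + (dFun c₁ c₂ m (sepVar c₁ c₂ R 0 m)
                      * Complex.cosh (4 * momentum (ρ 0) (ℓ 0) m * ρ 0 m)
                    - dFun c₁ c₂ m (sepVar c₁ c₂ R 1 m)
                      * Complex.cosh (4 * momentum (ρ 1) (ℓ 1) m * ρ 1 m))
                  / (2 * (sepVar c₁ c₂ R 0 m - sepVar c₁ c₂ R 1 m))) ∧
          -- the separated equations
          (∀ i, ∀ m ∈ U,
            2 * sepVar c₁ c₂ R i m ^ 3
                + (2 * Ham c₁ c₂ m + c₂ ^ 2 * casA m) * sepVar c₁ c₂ R i m ^ 2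
                - kappa c₁ c₂ m * sepVar c₁ c₂ R i m + c₁ ^ 2 * casB m ^ 2
              = (c₂ ^ 2 * sepVar c₁ c₂ R i m - c₁ ^ 2)
                * (casA m * sepVar c₁ c₂ R i m + casB m ^ 2)
                * Complex.cosh (4 * momentum (ρ i) (ℓ i) m * ρ i m))) := by
  refine ⟨fun m => ⟨bracket_casA _ m, bracket_casB _ m, bracket_Ham_Kint c₁ c₂ m, ?_, ?_⟩, ?_⟩
  · rw [bracket_Ham_z₁_sq]; ring
  · rw [bracket_Ham_z₂_sq]; ring
  intro U R hU hR hUR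
  have hroot : ∀ m ∈ U, IsRootAt c₁ c₂ R m := fun m hm => by
    have hsq : ∀ᶠ n in nhds m, R n ^ 2 = F c₁ c₂ n (z₁ n) * F c₁ c₂ n (z₂ n) := by
      filter_upwards [hU.mem_nhds hm] with n hn using (hUR n hn).2.2
    refine ⟨contDiffAt_of_sq (hR.continuousAt (hU.mem_nhds hm)) (hUR m hm).2.1 ?_,
      (hUR m hm).2.1, hsq, sub_ne_zero.mpr (hUR m hm).1⟩
    exact ((contDiff_F c₁ c₂ contDiff_z₁).mul
      (contDiff_F c₁ c₂ contDiff_z₂)).contDiffAt.congr_of_eventuallyEq hsq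
  have hsm : ∀ i, ∀ m ∈ U, ContDiffAt 𝕜 ∞ (sepVar c₁ c₂ R i) m := fun i m hm => by
    obtain ⟨r, h1, -, hr⟩ := exists_sepVar_eq c₁ c₂ R i
    rw [h1]
    exact (hr m (hroot m hm)).contDiffAt_kowVar
  have hne : ∀ m ∈ U, sepVar c₁ c₂ R 0 m ≠ sepVar c₁ c₂ R 1 m := fun m hm => by
    rw [sepVar_zero, sepVar_one]
    exact sub_ne_zero.mp (hroot m hm).kowVar_sub_ne_zero
  have hss : ∀ m ∈ U, bracket (sepVar c₁ c₂ R 0) (sepVar c₁ c₂ R 1) m = 0 := fun m hm => by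
    rw [sepVar_zero, sepVar_one]
    exact (hroot m hm).bracket_kowVar
  -- the root of `P₅(s_i)` is read off from the equation of motion
  let q : Fin 2 → E3 𝕜 → ℂ := fun i m =>
    (sepVar c₁ c₂ R i m - sepVar c₁ c₂ R (1 - i) m) * bracket (Ham c₁ c₂) (sepVar c₁ c₂ R i) m
  have hq2 : ∀ i, ∀ m ∈ U, q i m ^ 2 = P₅ c₁ c₂ m (sepVar c₁ c₂ R i m) := fun i m hm => by
    obtain ⟨r, h1, h2, hr⟩ := exists_sepVar_eq c₁ c₂ R i
    simp only [q]
    rw [h1, h2]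
    exact (hr m (hroot m hm)).velocity_sq
  have hqs : ∀ i, ∀ m ∈ U, ContDiffAt 𝕜 ∞ (q i) m := fun i m hm =>
    ((hsm i m hm).sub (hsm (1 - i) m hm)).mul
      (contDiffAt_bracket (contDiff_Ham c₁ c₂).contDiffAt (hsm i m hm))
  refine ⟨fun i m hm => (hsm i m hm).contDiffWithinAt, hne, hss, q, hq2, fun m hm => ?_, ?_⟩
  · have h1 := sub_ne_zero.mpr (hne m hm)
    have h2 := sub_ne_zero.mpr (hne m hm).symm
    constructor
    · rw [eq_div_iff h1, mul_comm]; rfl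
    · rw [eq_div_iff h2, mul_comm]; rfl
  intro ρ ℓ hcont hbr
  have hmom : ∀ i r, sepVar c₁ c₂ R i = kowVar c₁ c₂ r →
      sepVar c₁ c₂ R (1 - i) = kowVar c₁ c₂ (fun n => -r n) → ∀ m ∈ U, IsRootAt c₁ c₂ r m →
      ContDiffAt 𝕜 ∞ (momentum (ρ i) (ℓ i)) m ∧
        IsMomentumAt c₁ c₂ r (momentum (ρ i) (ℓ i)) m := fun i r h1 h2 m hm hr => by
    have hUm := hU.mem_nhds hm
    have hb := hbr i
    have hq2' := hq2 i
    have hqm : q i m = (sepVar c₁ c₂ R i m - sepVar c₁ c₂ R (1 - i) m)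
      * bracket (Ham c₁ c₂) (sepVar c₁ c₂ R i) m := rfl
    rw [h1] at hb hq2'
    rw [h1, h2] at hqm
    refine hr.momentum ((hcont i).1.continuousAt hUm) ((hcont i).2.continuousAt hUm)
      (hqs i m hm) hqm (hb m hm).1 (hb m hm).2.1 ?_
    filter_upwards [hUm] with n hn
    exact ⟨(hb n hn).2.2.1, (hb n hn).2.2.2.1, hq2' n hn, (hb n hn).2.2.2.2⟩
  have hcan : ∀ i j, ∀ m ∈ U,
      bracket (sepVar c₁ c₂ R i) (momentum (ρ j) (ℓ j)) m = if i = j then 1 else 0 := by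
    intro i j m hm
    obtain ⟨r, h1, h2, hr'⟩ := exists_sepVar_eq c₁ c₂ R j
    have hr := hr' m (hroot m hm)
    have hp := (hmom j r h1 h2 m hm hr).2
    split_ifs with hij
    · rw [hij, h1]
      exact hp.bracket_kowVar_self hr
    · have hi : i = 1 - j := by omega
      rw [hi, h2]
      exact hp.bracket_kowVar_neg hr
  have hpp : ∀ m ∈ U, bracket (momentum (ρ 0) (ℓ 0)) (momentum (ρ 1) (ℓ 1)) m = 0 := by
    intro m hm
    have hr := hroot m hm
    have h0 := (hmom 0 R (sepVar_zero c₁ c₂ R) (sepVar_one c₁ c₂ R) m hm hr).2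
    have h1 := (hmom 1 _ (sepVar_one c₁ c₂ R) (by simpa using sepVar_zero c₁ c₂ R) m hm hr.neg).2
    exact h0.bracket_momentum h1 hr
  have hsep : ∀ i, ∀ m ∈ U,
      2 * sepVar c₁ c₂ R i m ^ 3
        + (2 * Ham c₁ c₂ m + c₂ ^ 2 * casA m) * sepVar c₁ c₂ R i m ^ 2
        - kappa c₁ c₂ m * sepVar c₁ c₂ R i m + c₁ ^ 2 * casB m ^ 2
      = (c₂ ^ 2 * sepVar c₁ c₂ R i m - c₁ ^ 2)
        * (casA m * sepVar c₁ c₂ R i m + casB m ^ 2)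
        * Complex.cosh (4 * momentum (ρ i) (ℓ i) m * ρ i m) := by
    intro i m hm
    obtain ⟨hs, -, hN, hρ, he⟩ := hbr i m hm
    have hρ0 : ρ i m ≠ 0 := fun h0 => hs (by rw [← hρ, h0]; simp)
    have hl : 4 * momentum (ρ i) (ℓ i) m * ρ i m = ℓ i m := by
      rw [momentum]; field_simp
    have h := (cosh_sinh_mul_momDen hN (by rw [mul_pow, hρ, hq2 i m hm]) he).1
    rw [← momNum_eq, momNum, momDen] at h
    rw [hl, kappa]
    linear_combination h / 4
  refine ⟨fun i m hm => ?_, hcan, hpp, fun m hm v hA hB hv => ?_, fun m hm => ?_, hsep⟩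
  · obtain ⟨r, h1, h2, hr⟩ := exists_sepVar_eq c₁ c₂ R i
    exact (hmom i r h1 h2 m hm (hr m (hroot m hm))).1.contDiffWithinAt
  · exact eq_zero_of_canonical (hcan 0 0 m hm) (hcan 1 1 m hm) (hcan 0 1 m hm) (hcan 1 0 m hm)
      (hss m hm) (hpp m hm) hA hB (hv 0).1 (hv 1).1 (hv 0).2 (hv 1).2
  · have h0 := hsep 0 m hm
    have h1 := hsep 1 m hm
    have hs0 := (hbr 0 m hm).1
    have hs1 := (hbr 1 m hm).1
    have h01 := sub_ne_zero.mpr (hne m hm)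
    rw [dFun, dFun, div_mul_eq_mul_div, div_mul_eq_mul_div, ← h0, ← h1]
    field_simp
    ring
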